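/- Let $\Lambda\subset\mathbb Z$ be a finite set of sites, where site $i$ is a quantum system with $d_i\ge 1$ levels, let $\mathcal H=\bigotimes_{i\in\Lambda}\mathbb C^{d_i}$, let $\|\cdot\|$ be the operator norm on $\mathcal B(\mathcal H)$, and let $\|K\|_\infty=\sup_{O\ne0}\|K(O)\|/\|O\|$ for a superoperator $K$ on $\mathcal B(\mathcal H)$. A two-body long-range Liouvillian with exponent $\alpha$ is given by $\mathcal L^\dagger=\sum_{Z\subset\Lambda}\mathcal L_Z^\dagger$, where each $\mathcal L_Z^\dagger$ is an adjoint Lindblad superoperator $$\mathcal L_Z^\dagger O=i[H_Z,O]+\sum_k\Big(J_{Z,k}^\dagger OJ_{Z,k}-\tfrac12\{J_{Z,k}^\dagger J_{Z,k},O\}\Big)$$ with finitely many jump operators, $H_Z=H_Z^\dagger$ and all $J_{Z,k}$ supported on $Z$, where $\mathcal L_Z^\dagger=0$ if $|Z|>2$, and where $\sum_{Z\ni i,j}\|\mathcal L_Z^\dagger\|_\infty\le|i-j|^{-\alpha}$ for all sites $i\ne j$ (single-site terms are allowed and are not restricted in strength). For disjoint non-empty $X,Y\subset\Lambda$ let $r=d(X,Y)=\min_{x\in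 X,\,y\in Y}|x-y|$, and let $\kappa(X,Y)$ be the number of pairs $(x,y)\in X\times Y$ such that no site of $X\cup Y$ lies strictly between $x$ and $y$. (Thus $\kappa(X,Y)=1$ if $X$ lies entirely on one side of $Y$, and $\kappa(X,Y)\le2$ if $X$ or $Y$ is a single site.) **Theorem.** For all $\alpha>3$ and $\varepsilon>0$ there are constants $C,v>0$, depending only on $\alpha$ and $\varepsilon$, such that for every finite $\Lambda\subset\mathbb Z$, all local dimensions $d_i$, every two-body long-range Liouvillian on $\Lambda$ with exponent $\alpha$, all disjoint non-empty $X,Y\subset\Lambda$, every operator $A$ supported on $X$, every linear superoperator $K_Y$ supported on $Y$ (that is, $K_Y=K\otimes\mathrm{id}$ with $K$ acting on the operators on $Y$) with $K_Y(\mathbb 1)=0$ (for example every adjoint Liouvillian supported on $Y$, or $O\mapsto i[O,O_Y]$), and all times $0\le t\le r/v$, $$\big\|K_Y\big(e^{\mathcal L^\dagger t}A\big)\big\|\le C\,\kappa(X,Y)\,\|K_Y\|_\infty\,\|A\|\,\frac{t}{r^{\alpha-2-\varepsilon}} .$$ In particular the light cone is linear: if $\varepsilon<\alpha-3$ and $\kappa(X,Y)$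 is bounded, the right-hand side, relative to $\|K_Y\|_\infty\|A\|$, tends to $0$ as $r\to\infty$, uniformly in $0\le t\le r/v$. -/

import Mathlib

open scoped Matrix.Norms.L2Operator

/-- Basis configurations of the sites in `S`, for a one-dimensional lattice of sites labelled by
integers, where site `i` is a system with `d i` levels. -/
abbrev Config (d : ℤ → ℕ) {Λ : Finset ℤ} (S : Finset Λ) : Type := (i : S) → Fin (d i.1.1)

/-- Basis configurations of the whole lattice `Λ`. -/
abbrev LatticeConfig (d : ℤ → ℕ) (Λ : Finset ℤ) : Type := (i : Λ) → Fin (d i.1)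

/-- The algebra `B(H)` of operators on `H = ⨂_{i ∈ Λ} ℂ^{d i}`, as matrices in the product basis.
Its norm is the operator norm for the Hilbert space norm. -/
abbrev Op (d : ℤ → ℕ) (Λ : Finset ℤ) : Type :=
  Matrix (LatticeConfig d Λ) (LatticeConfig d Λ) ℂ

/-- Superoperators, i.e. linear maps `B(H) → B(H)`. The norm of `K` in this type is
`sup_O ‖K O‖ / ‖O‖`, the `∞ → ∞` norm. -/
abbrev SuperOp (d : ℤ → ℕ) (Λ : Finset ℤ) : Type := Op d Λ →L[ℂ] Op d Λ

/-- Restriction of a configuration of the lattice to the sites in `S`. -/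
def restrictConfig {d : ℤ → ℕ} {Λ : Finset ℤ} (S : Finset Λ) (σ : LatticeConfig d Λ) :
    Config d S := fun i => σ i.1

open Classical in
/-- The operator `B ⊗ 1` on the whole lattice, for an operator `B` on the sites in `S`. -/
noncomputable def extendOp {d : ℤ → ℕ} {Λ : Finset ℤ} (S : Finset Λ)
    (B : Matrix (Config d S) (Config d S) ℂ) : Op d Λ :=
  Matrix.of fun σ τ =>
    if ∀ i, i ∉ S → σ i = τ i then B (restrictConfig S σ) (restrictConfig S τ) else 0

/-- `A` is supported on `S`: it has the form `B ⊗ 1` with `B` acting on the sites in `S`. -/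
def SupportedOn {d : ℤ → ℕ} {Λ : Finset ℤ} (S : Finset Λ) (A : Op d Λ) : Prop :=
  ∃ B : Matrix (Config d S) (Config d S) ℂ, A = extendOp S B

/-- The superoperator `K` is supported on `S`, i.e. `K = K_S ⊗ id`: it maps operators on `S` to
operators on `S`, and `K (O * B) = K O * B` for `O` on `S` and `B` on the complement of `S`. -/
def SuperSupportedOn {d : ℤ → ℕ} {Λ : Finset ℤ} (S : Finset Λ) (K : SuperOp d Λ) : Prop :=
  ∀ O : Op d Λ, SupportedOn S O →
    SupportedOn S (K O) ∧ ∀ B : Op d Λ, SupportedOn Sᶜ B → K (O * B) = K O * B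

/-- The adjoint (Heisenberg-picture) Lindblad superoperator with Hamiltonian `H` and jump
operators `J k`, evaluated at `O`. -/
noncomputable def adjointLindblad {d : ℤ → ℕ} {Λ : Finset ℤ} (H : Op d Λ) {n : ℕ}
    (J : Fin n → Op d Λ) (O : Op d Λ) : Op d Λ :=
  Complex.I • (H * O - O * H) +
    ∑ k, ((J k).conjTranspose * O * J k -
      (1 / 2 : ℂ) • ((J k).conjTranspose * J k * O + O * ((J k).conjTranspose * J k)))

/-- `K` is the adjoint of a Liouvillian whose Hamiltonian and jump operators are supported
on `S`. -/
def IsAdjointLiouvillianOn {d : ℤ → ℕ} {Λ : Finset ℤ} (S : Finset Λ) (K : SuperOp d Λ) : Prop :=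
  ∃ (H : Op d Λ) (n : ℕ) (J : Fin n → Op d Λ),
    H.IsHermitian ∧ SupportedOn S H ∧ (∀ k, SupportedOn S (J k)) ∧
      ∀ O, K O = adjointLindblad H J O

/-- `∑_Z L Z`, with `L Z` the adjoint Liouvillian acting on `Z`, is (the adjoint of) a two-body
long-range Liouvillian with exponent `α`. Single-site terms are allowed and their strength is not
restricted. -/
structure IsTwoBodyLongRange {d : ℤ → ℕ} {Λ : Finset ℤ} (α : ℝ)
    (L : Finset Λ → SuperOp d Λ) : Prop where
  liouvillian : ∀ Z, IsAdjointLiouvillianOn Z (L Z)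
  twoBody : ∀ Z, 2 < Z.card → L Z = 0
  decay : ∀ i j : Λ, i ≠ j →
    ∑ Z with i ∈ Z ∧ j ∈ Z, ‖L Z‖ ≤ 1 / (|(i : ℤ) - (j : ℤ)| : ℝ) ^ α

/-- The distance between two (non-empty) sets of sites. -/
noncomputable def siteDist {Λ : Finset ℤ} (X Y : Finset Λ) : ℕ :=
  sInf {n : ℕ | ∃ i ∈ X, ∃ j ∈ Y, n = ((i : ℤ) - (j : ℤ)).natAbs}

/-- The number of pairs `(x, y) ∈ X × Y` with no site of `X ∪ Y` strictly between `x` and `y`.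
For disjoint `X` and `Y` it is the number of times one passes from one set to the other while
running through `X ∪ Y` from left to right: it is `1` when `X` lies on one side of `Y`, and at
most `2` when `X` or `Y` is a single site. -/
noncomputable def interfaceCount {Λ : Finset ℤ} (X Y : Finset Λ) : ℕ :=
  ((X ×ˢ Y).filter fun p => ∀ z ∈ X ∪ Y, ¬ (min p.1 p.2 < z ∧ z < max p.1 p.2)).card

/-! Heisenberg-picture Lindblad semigroups contract the operator norm
(`IsAdjointLiouvillianOn.isDissipative`), and dropping local terms leaves another such semigroup. By
Duhamel's formula the effect of dropping terms is therefore at most the time multiplied by the rate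
at which they act on the evolved operator. Single-site terms are never dropped, so their strength
plays no role.

Terms of range above `R` that touch a window of length `l` have total strength of order `∑_{n > R}
(n + l + 1) n ^ (-α)`, which is about `l ^ (-(α - 2))` when `R = l ^ (1 - η)` with small `η`. During
a time of order `l` they act about `l ^ (3 - α)` times: rarely, precisely because `α > 3`.

The core is an induction on scales for `WindowBound`, from `s = l ^ (1 - η)` to `l`. The front
advances in steps of length `s`. In each step two kinds of terms are dropped: those too long for
scale `s`, and the short ones that cross the end of the current window. The latter see only the
weight near that end, which is small by the bound at scale `s`. Hence dropped terms act at a rate of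
order `s ^ (-a)`, with `a` slightly below `α - 2`. When one acts, the front jumps a bounded number
of windows further; `m` such events cost `(s ^ (-a) * l) ^ m`, which is at most `l ^ (-a)` for a
fixed large `m` (`WindowBound.step`). The loss of speed between scales is absorbed by the factor `1
+ l ^ (-η)` in `scaleTime`, so the velocity stays bounded (`LocalDynamics.windowBound`).

Finally a window of length `r / 2` is placed at every interface between `X` and `Y`, and terms are
dropped once more. What remains cannot connect `X` to `Y`, and each interface contributes a rate of
order `r ^ (-a)` (`LocalDynamics.norm_apply_exp_le_interfaces`). -/

open Filter Topology in
/-- If `‖1 + h x‖ ≤ 1 + c h²` for all `h ≥ 0`, then `x` generates a contraction semigroup. -/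
theorem norm_exp_smul_le_one {𝔸 : Type*} [NormedRing 𝔸] [NormedAlgebra ℂ 𝔸] [CompleteSpace 𝔸]
    {x : 𝔸} {c : ℝ} (hx : ∀ h : ℝ, 0 ≤ h → ‖1 + (h : ℂ) • x‖ ≤ 1 + c * h ^ 2) {t : ℝ}
    (ht : 0 ≤ t) : ‖NormedSpace.exp ((t : ℂ) • x)‖ ≤ 1 := by
  have key : ∀ ε : ℝ, 0 < ε → ‖NormedSpace.exp ((t : ℂ) • x)‖ ≤ Real.exp (2 * ε * t) := by
    intro ε hε
    have hd : HasDerivAt (fun h : ℝ => NormedSpace.exp (h • x)) x 0 := by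
      have := hasDerivAt_exp_smul_const (𝕂 := ℝ) x 0
      simpa using this
    have h1 := (hasDerivAt_iff_isLittleO_nhds_zero.mp hd).def hε
    have hlim : Tendsto (fun n : ℕ => t / (n : ℝ)) atTop (𝓝 0) :=
      tendsto_const_div_atTop_nhds_zero_nat t
    have h2 : ∀ᶠ n : ℕ in atTop, c * (t / n) < ε := by
      have : Tendsto (fun n : ℕ => c * (t / (n : ℝ))) atTop (𝓝 (c * 0)) := hlim.const_mul c
      rw [mul_zero] at this
      exact this.eventually_lt_const hε
    obtain ⟨n, ⟨h3, h4⟩, h5⟩ := ((hlim.eventually h1).and h2 |>.and (eventually_gt_atTop 0)).exists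
    have hn : (0 : ℝ) < n := by exact_mod_cast h5
    have hh : 0 ≤ t / n := by positivity
    set h := t / n with hdef
    -- The Taylor remainder and the error `c h²` each cost at most `ε h`; the power `n` turns this
    -- into `exp (2 ε t)`.
    have h6 : ‖NormedSpace.exp ((h : ℂ) • x)‖ ≤ 1 + 2 * ε * h := by
      have e1 : ‖NormedSpace.exp ((h : ℂ) • x) - (1 + (h : ℂ) • x)‖ ≤ ε * h := by
        have := h3
        simp only [zero_add, zero_smul, NormedSpace.exp_zero, Real.norm_eq_abs,
          abs_of_nonneg hh] at this
        rw [Complex.coe_smul, ← sub_sub]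
        exact this
      have e2 := hx h hh
      have e3 : c * h ^ 2 ≤ ε * h := by nlinarith
      calc ‖NormedSpace.exp ((h : ℂ) • x)‖
          = ‖(NormedSpace.exp ((h : ℂ) • x) - (1 + (h : ℂ) • x)) + (1 + (h : ℂ) • x)‖ := by
            rw [sub_add_cancel]
        _ ≤ ε * h + (1 + c * h ^ 2) := (norm_add_le _ _).trans (add_le_add e1 e2)
        _ ≤ 1 + 2 * ε * h := by linarith
    have h7 : (t : ℂ) • x = n • ((h : ℂ) • x) := by
      rw [← Nat.cast_smul_eq_nsmul ℂ, smul_smul]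
      congr 1
      have : t = n * h := by rw [hdef]; field_simp
      rw [this]; push_cast; rfl
    let _ : NormedAlgebra ℚ 𝔸 := NormedAlgebra.restrictScalars ℚ ℂ 𝔸
    rw [h7, NormedSpace.exp_nsmul]
    calc ‖NormedSpace.exp ((h : ℂ) • x) ^ n‖ ≤ ‖NormedSpace.exp ((h : ℂ) • x)‖ ^ n :=
          norm_pow_le' _ h5
      _ ≤ (1 + 2 * ε * h) ^ n := by gcongr
      _ ≤ Real.exp (2 * ε * h) ^ n := by
          gcongr
          linarith [Real.add_one_le_exp (2 * ε * h)]
      _ = Real.exp (2 * ε * t) := by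
          rw [← Real.exp_nat_mul]; congr 1; rw [hdef]; field_simp
  have hl : Tendsto (fun ε : ℝ => Real.exp (2 * ε * t)) (𝓝[>] 0) (𝓝 1) := by
    have : Continuous fun ε : ℝ => Real.exp (2 * ε * t) := by fun_prop
    have := (this.tendsto 0).mono_left (nhdsWithin_le_nhds (s := Set.Ioi 0))
    simpa using this
  exact ge_of_tendsto hl (eventually_nhdsWithin_of_forall fun ε hε => key ε hε)

/-! ### Invariant subspaces and Duhamel's formula -/

section Semigroup

variable {E : Type*} [NormedAddCommGroup E] [NormedSpace ℂ E] [CompleteSpace E]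

/-- Exponentials of an operator preserve every closed invariant subspace. -/
theorem exp_smul_apply_mem {G : E →L[ℂ] E} {W : Submodule ℂ E} (hW : IsClosed (W : Set E))
    (hG : ∀ x ∈ W, G x ∈ W) (z : ℂ) {x : E} (hx : x ∈ W) :
    NormedSpace.exp (z • G) x ∈ W := by
  have hs := NormedSpace.exp_series_hasSum_exp' (𝕂 := ℂ) (z • G)
  have hs' : HasSum (fun n : ℕ => ((n.factorial : ℂ)⁻¹ • (z • G) ^ n) x)
      (NormedSpace.exp (z • G) x) := hs.mapL (ContinuousLinearMap.apply ℂ E x)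
  have hpow : ∀ n : ℕ, ((z • G) ^ n) x ∈ W := by
    intro n
    induction n with
    | zero => simpa using hx
    | succ n ih =>
      rw [pow_succ']
      exact W.smul_mem _ (hG _ ih)
  exact hW.mem_of_tendsto hs' (Filter.Eventually.of_forall fun s => W.sum_mem fun n _ =>
    W.smul_mem _ (hpow n))

/-- Duhamel's formula as an inequality: comparison of the evolution under `G` with the evolution
under `G'` during the initial time interval `[0, τ]`. -/
theorem norm_exp_apply_le_add (K G G' : E →L[ℂ] E) (x : E) {T τ M : ℝ} (hτ : 0 ≤ τ)
    (hM : ∀ s, 0 ≤ s → s ≤ τ →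
      ‖K (NormedSpace.exp (((T - s : ℝ) : ℂ) • G)
        ((G - G') (NormedSpace.exp ((s : ℂ) • G') x)))‖ ≤ M) :
    ‖K (NormedSpace.exp ((T : ℂ) • G) x)‖ ≤
      ‖K (NormedSpace.exp (((T - τ : ℝ) : ℂ) • G) (NormedSpace.exp ((τ : ℂ) • G') x))‖ + M * τ := by
  -- Interpolates between the evolution under `G` alone (`s = 0`) and `G'` during `[0, τ]` followed
  -- by `G` (`s = τ`).
  let f : ℝ → E →L[ℂ] E := fun s =>
    NormedSpace.exp ((T - s) • G) * NormedSpace.exp (s • G')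
  have hf : ∀ s : ℝ, HasDerivAt f
      (-(NormedSpace.exp ((T - s) • G) * (G - G') * NormedSpace.exp (s • G'))) s := by
    intro s
    have h1 : HasDerivAt (fun s : ℝ => NormedSpace.exp ((T - s) • G))
        (-(NormedSpace.exp ((T - s) • G) * G)) s := by
      have := (hasDerivAt_exp_smul_const (𝕂 := ℝ) G (T - s)).scomp s
        ((hasDerivAt_id s).const_sub T)
      rw [neg_one_smul] at this
      exact this
    have h2 := hasDerivAt_exp_smul_const' (𝕂 := ℝ) G' s
    have e : -(NormedSpace.exp ((T - s) • G) * (G - G') * NormedSpace.exp (s • G')) =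
        -(NormedSpace.exp ((T - s) • G) * G) * NormedSpace.exp (s • G') +
          NormedSpace.exp ((T - s) • G) * (G' * NormedSpace.exp (s • G')) := by
      noncomm_ring
    rw [e]
    exact h1.mul h2
  let L : (E →L[ℂ] E) →L[ℝ] E :=
    ((K.comp (ContinuousLinearMap.id ℂ E)).comp
      (ContinuousLinearMap.apply ℂ E x : (E →L[ℂ] E) →L[ℂ] E)).restrictScalars ℝ
  have hL : ∀ B : E →L[ℂ] E, L B = K (B x) := fun B => rfl
  have hg : ∀ s : ℝ, HasDerivAt (fun s => K (f s x))
      (K ((-(NormedSpace.exp ((T - s) • G) * (G - G') * NormedSpace.exp (s • G'))) x)) s :=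
    fun s => L.hasFDerivAt.comp_hasDerivAt s (hf s)
  have hmv := norm_image_sub_le_of_norm_deriv_le_segment' (a := 0) (b := τ) (C := M)
    (fun s _ => (hg s).hasDerivWithinAt) (fun s hs => by
      have := hM s hs.1 hs.2.le
      rw [neg_apply, map_neg, norm_neg]
      simp only [Complex.coe_smul] at this
      exact this) τ ⟨hτ, le_rfl⟩
  have e0 : f 0 x = NormedSpace.exp ((T : ℂ) • G) x := by
    simp [f, NormedSpace.exp_zero]
  have e1 : f τ x = NormedSpace.exp (((T - τ : ℝ) : ℂ) • G) (NormedSpace.exp ((τ : ℂ) • G') x) := by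
    simp only [f, Complex.coe_smul]; rfl
  rw [e0, e1, sub_zero] at hmv
  have := norm_sub_norm_le (K (NormedSpace.exp ((T : ℂ) • G) x))
    (K (NormedSpace.exp (((T - τ : ℝ) : ℂ) • G) (NormedSpace.exp ((τ : ℂ) • G') x)))
  rw [norm_sub_rev] at hmv
  linarith

end Semigroup

/-! ### Norms of completely positive maps -/

section Kraus

variable {n ι : Type*} [Fintype n] [DecidableEq n] [Fintype ι]

/-- A completely positive map `O ↦ ∑ k, (V k)ᴴ O V k` has norm at most `‖∑ k, (V k)ᴴ V k‖`. -/
theorem norm_sum_conjTranspose_mul_mul_le (V : ι → Matrix n n ℂ) (O : Matrix n n ℂ) :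
    ‖∑ k, (V k).conjTranspose * O * V k‖ ≤ ‖∑ k, (V k).conjTranspose * V k‖ * ‖O‖ := by
  let Φ : Matrix n n ℂ ≃⋆ₐ[ℂ] (EuclideanSpace ℂ n →L[ℂ] EuclideanSpace ℂ n) :=
    Matrix.toEuclideanCLM (n := n) (𝕜 := ℂ)
  have hΦ : ∀ A, ‖Φ A‖ = ‖A‖ := fun A => rfl
  have hinner : ∀ (A : Matrix n n ℂ) (u w : EuclideanSpace ℂ n),
      inner ℂ u (Φ A.conjTranspose w) = inner ℂ (Φ A u) w := by
    intro A u w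
    rw [← Matrix.star_eq_conjTranspose, map_star, ContinuousLinearMap.star_eq_adjoint,
      ContinuousLinearMap.adjoint_inner_right]
  set S := ‖∑ k, (V k).conjTranspose * V k‖ with hS
  have hsq : ∀ u : EuclideanSpace ℂ n, ∑ k, ‖Φ (V k) u‖ ^ 2 ≤ S * ‖u‖ ^ 2 := by
    intro u
    have e : ((∑ k, ‖Φ (V k) u‖ ^ 2 : ℝ) : ℂ) =
        inner ℂ u (Φ (∑ k, (V k).conjTranspose * V k) u) := by
      rw [map_sum, sum_apply, inner_sum]
      push_cast
      refine Finset.sum_congr rfl fun k _ => ?_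
      rw [map_mul, mul_apply_eq_comp, hinner, inner_self_eq_norm_sq_to_K]
      rfl
    have e2 : ∑ k, ‖Φ (V k) u‖ ^ 2 = ‖((∑ k, ‖Φ (V k) u‖ ^ 2 : ℝ) : ℂ)‖ := by
      rw [Complex.norm_real, Real.norm_of_nonneg (by positivity)]
    rw [e2, e]
    calc _ ≤ ‖u‖ * ‖Φ (∑ k, (V k).conjTranspose * V k) u‖ := norm_inner_le_norm _ _
      _ ≤ ‖u‖ * (S * ‖u‖) := by
          gcongr
          exact ContinuousLinearMap.le_opNorm _ _
      _ = S * ‖u‖ ^ 2 := by ring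
  have hS0 : 0 ≤ S := norm_nonneg _
  rw [← hΦ]
  refine ContinuousLinearMap.opNorm_le_bound _ (by positivity) fun w => ?_
  set T := Φ (∑ k, (V k).conjTranspose * O * V k) with hT
  -- Cauchy–Schwarz in the space and then in the index `k`, with `hsq` for both factors; afterwards
  -- `u = T w`.
  have hb : ∀ u, ‖inner ℂ u (T w)‖ ≤ S * ‖O‖ * ‖w‖ * ‖u‖ := by
    intro u
    have e : inner ℂ u (T w) = ∑ k, inner ℂ (Φ (V k) u) (Φ O (Φ (V k) w)) := by
      rw [hT, map_sum, sum_apply, inner_sum]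
      refine Finset.sum_congr rfl fun k _ => ?_
      rw [map_mul, map_mul, mul_apply_eq_comp, mul_apply_eq_comp, hinner]
    rw [e]
    calc ‖∑ k, inner ℂ (Φ (V k) u) (Φ O (Φ (V k) w))‖
        ≤ ∑ k, ‖Φ (V k) u‖ * (‖O‖ * ‖Φ (V k) w‖) := by
          refine (norm_sum_le _ _).trans (Finset.sum_le_sum fun k _ => ?_)
          refine (norm_inner_le_norm _ _).trans ?_
          gcongr
          exact ContinuousLinearMap.le_opNorm _ _
      _ = ‖O‖ * ∑ k, ‖Φ (V k) u‖ * ‖Φ (V k) w‖ := by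
          rw [Finset.mul_sum]; exact Finset.sum_congr rfl fun k _ => by ring
      _ ≤ ‖O‖ * (S * ‖u‖ * ‖w‖) := by
          gcongr
          refine abs_le_of_sq_le_sq' ?_ (by positivity) |>.2
          calc (∑ k, ‖Φ (V k) u‖ * ‖Φ (V k) w‖) ^ 2
              ≤ (∑ k, ‖Φ (V k) u‖ ^ 2) * ∑ k, ‖Φ (V k) w‖ ^ 2 := Finset.sum_mul_sq_le_sq_mul_sq _ _ _
            _ ≤ (S * ‖u‖ ^ 2) * (S * ‖w‖ ^ 2) := by
                gcongr
                · exact hsq u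
                · exact hsq w
            _ = (S * ‖u‖ * ‖w‖) ^ 2 := by ring
      _ = S * ‖O‖ * ‖w‖ * ‖u‖ := by ring
  have h1 := hb (T w)
  rw [inner_self_eq_norm_sq_to_K] at h1
  have h2 : ‖T w‖ * ‖T w‖ ≤ S * ‖O‖ * ‖w‖ * ‖T w‖ := by
    simpa [pow_two] using h1
  rcases (norm_nonneg (T w)).eq_or_lt with h | h
  · rw [← h]; positivity
  · exact le_of_mul_le_mul_right h2 h

end Kraus

/-! ### Supports of operators and superoperators -/

section Support

variable {d : ℤ → ℕ} {Λ : Finset ℤ}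

open Classical in
/-- A configuration of the lattice as a pair of configurations of `S` and of its complement. -/
noncomputable def splitConfig (S : Finset Λ) :
    LatticeConfig d Λ ≃ Config d S × Config d Sᶜ where
  toFun σ := (restrictConfig S σ, restrictConfig Sᶜ σ)
  invFun p i := if h : i ∈ S then p.1 ⟨i, h⟩ else p.2 ⟨i, Finset.mem_compl.2 h⟩
  left_inv σ := by
    funext i
    by_cases h : i ∈ S <;> simp [h, restrictConfig]
  right_inv p := by
    refine Prod.ext ?_ ?_ <;> funext i
    · simp [restrictConfig, i.2]
    · have := Finset.mem_compl.1 i.2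
      simp [restrictConfig, this]

open scoped Kronecker in
theorem extendOp_eq_submatrix (S : Finset Λ) (B : Matrix (Config d S) (Config d S) ℂ) :
    extendOp S B = (B ⊗ₖ (1 : Matrix (Config d Sᶜ) (Config d Sᶜ) ℂ)).submatrix
      (splitConfig S) (splitConfig S) := by
  ext σ τ
  have h : (∀ i, i ∉ S → σ i = τ i) ↔ restrictConfig Sᶜ σ = restrictConfig Sᶜ τ := by
    constructor
    · intro h
      funext i
      exact h i.1 (Finset.mem_compl.1 i.2)
    · intro h i hi
      exact congrFun h ⟨i, Finset.mem_compl.2 hi⟩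
  simp only [extendOp, Matrix.of_apply, Matrix.submatrix_apply, Matrix.kroneckerMap_apply,
    Matrix.one_apply, splitConfig, Equiv.coe_fn_mk, h, mul_ite, mul_one, mul_zero]

theorem SupportedOn.mul {S : Finset Λ} {A B : Op d Λ} (hA : SupportedOn S A)
    (hB : SupportedOn S B) : SupportedOn S (A * B) := by
  obtain ⟨a, rfl⟩ := hA
  obtain ⟨b, rfl⟩ := hB
  refine ⟨a * b, ?_⟩
  simp only [extendOp_eq_submatrix]
  rw [Matrix.submatrix_mul_equiv, ← Matrix.mul_kronecker_mul, one_mul]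

theorem SupportedOn.conjTranspose {S : Finset Λ} {A : Op d Λ} (hA : SupportedOn S A) :
    SupportedOn S A.conjTranspose := by
  obtain ⟨a, rfl⟩ := hA
  refine ⟨a.conjTranspose, ?_⟩
  simp only [extendOp_eq_submatrix]
  rw [Matrix.conjTranspose_submatrix, Matrix.conjTranspose_kronecker, Matrix.conjTranspose_one]

theorem supportedOn_one (S : Finset Λ) : SupportedOn S (1 : Op d Λ) := by
  refine ⟨1, ?_⟩
  rw [extendOp_eq_submatrix, Matrix.one_kronecker_one, Matrix.submatrix_one_equiv]

/-- The operators supported on `S` form a linear subspace. -/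
noncomputable def supportSubmodule (d : ℤ → ℕ) (S : Finset Λ) : Submodule ℂ (Op d Λ) where
  carrier := {A | SupportedOn S A}
  add_mem' := by
    rintro _ _ ⟨a, rfl⟩ ⟨b, rfl⟩
    refine ⟨a + b, ?_⟩
    ext σ τ
    simp only [extendOp, Matrix.add_apply, Matrix.of_apply]
    split_ifs <;> simp
  zero_mem' := ⟨0, by ext σ τ; simp [extendOp]⟩
  smul_mem' := by
    rintro c _ ⟨a, rfl⟩
    refine ⟨c • a, ?_⟩
    ext σ τ
    simp [extendOp]

theorem SupportedOn.mono {S T : Finset Λ} (hST : S ⊆ T) {A : Op d Λ} (hA : SupportedOn S A) :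
    SupportedOn T A := by
  classical
  obtain ⟨a, rfl⟩ := hA
  refine ⟨Matrix.of fun σ τ => if ∀ i : T, i.1 ∉ S → σ i = τ i then
    a (fun i => σ ⟨i.1, hST i.2⟩) (fun i => τ ⟨i.1, hST i.2⟩) else 0, ?_⟩
  ext σ τ
  have h : (∀ i, i ∉ S → σ i = τ i) ↔ (∀ i, i ∉ T → σ i = τ i) ∧
      ∀ i : T, i.1 ∉ S → restrictConfig T σ i = restrictConfig T τ i := by
    constructor
    · exact fun h => ⟨fun i hi => h i fun hS => hi (hST hS), fun i hi => h i.1 hi⟩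
    · rintro ⟨h1, h2⟩ i hi
      by_cases hT : i ∈ T
      · exact h2 ⟨i, hT⟩ hi
      · exact h1 i hT
  simp only [extendOp, Matrix.of_apply, h, ite_and]
  rfl

/-- After enlarging `T` to `Sᶜ`, the two operators are `a ⊗ 1` and `1 ⊗ b` in the same splitting. -/
theorem SupportedOn.commute {S T : Finset Λ} (hST : Disjoint S T) {A B : Op d Λ}
    (hA : SupportedOn S A) (hB : SupportedOn T B) : A * B = B * A := by
  classical
  have hB' : SupportedOn Sᶜ B :=
    hB.mono fun i hi => Finset.mem_compl.2 fun h => Finset.disjoint_left.1 hST h hi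
  obtain ⟨a, rfl⟩ := hA
  obtain ⟨b, rfl⟩ := hB'
  open scoped Kronecker in
  have hb : extendOp Sᶜ b = ((1 : Matrix (Config d S) (Config d S) ℂ) ⊗ₖ b).submatrix
      (splitConfig S) (splitConfig S) := by
    ext σ τ
    have h : (∀ i, i ∉ Sᶜ → σ i = τ i) ↔ restrictConfig S σ = restrictConfig S τ := by
      constructor
      · intro h
        funext i
        exact h i.1 (by simp)
      · intro h i hi
        exact congrFun h ⟨i, by simpa using hi⟩
    simp only [extendOp, Matrix.of_apply, Matrix.submatrix_apply, Matrix.kroneckerMap_apply,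
      Matrix.one_apply, splitConfig, Equiv.coe_fn_mk, h, ite_mul, one_mul, zero_mul]
  rw [hb, extendOp_eq_submatrix, Matrix.submatrix_mul_equiv, Matrix.submatrix_mul_equiv,
    ← Matrix.mul_kronecker_mul, ← Matrix.mul_kronecker_mul]
  simp

theorem isClosed_supportSubmodule (S : Finset Λ) :
    IsClosed (supportSubmodule d S : Set (Op d Λ)) :=
  Submodule.closed_of_finiteDimensional _

/-- `K` annihilates every operator that acts trivially on the sites in `T`. -/
def KillsOff (T : Finset Λ) (K : SuperOp d Λ) : Prop :=
  ∀ O : Op d Λ, SupportedOn Tᶜ O → K O = 0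

/-- `K O = K (1 * O) = K 1 * O`. This is all that the propagation argument needs to know about the
support of `K`. -/
theorem SuperSupportedOn.killsOff {S : Finset Λ} {K : SuperOp d Λ} (hK : SuperSupportedOn S K)
    (h1 : K 1 = 0) : KillsOff S K := by
  intro O hO
  have := (hK 1 (supportedOn_one S)).2 O hO
  rwa [one_mul, h1, zero_mul] at this

theorem IsAdjointLiouvillianOn.killsOff {S : Finset Λ} {K : SuperOp d Λ}
    (hK : IsAdjointLiouvillianOn S K) : KillsOff S K := by
  obtain ⟨H, n, J, -, hHS, hJS, h⟩ := hK
  intro O hO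
  have hd : Disjoint S Sᶜ := disjoint_compl_right
  have hJ : ∀ k, (J k).conjTranspose * O * J k = (J k).conjTranspose * J k * O := fun k => by
    rw [mul_assoc, ← (hJS k).commute hd hO, mul_assoc]
  have hJ' : ∀ k, O * ((J k).conjTranspose * J k) = (J k).conjTranspose * J k * O := fun k =>
    (((hJS k).conjTranspose.mul (hJS k)).commute hd hO).symm
  rw [h, adjointLindblad, hHS.commute hd hO, sub_self, smul_zero, zero_add]
  refine Finset.sum_eq_zero fun k _ => ?_
  rw [hJ, hJ', ← two_smul ℂ, smul_smul]
  norm_num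

theorem IsAdjointLiouvillianOn.supportedOn_apply {S T : Finset Λ} {K : SuperOp d Λ}
    (hK : IsAdjointLiouvillianOn S K) (hST : S ⊆ T) {O : Op d Λ} (hO : SupportedOn T O) :
    SupportedOn T (K O) := by
  obtain ⟨H, n, J, -, hHS, hJS, h⟩ := hK
  have hH := hHS.mono hST
  have hJ := fun k => (hJS k).mono hST
  rw [h, adjointLindblad]
  have hJJ := fun k => (hJ k).conjTranspose.mul (hJ k)
  refine (supportSubmodule d T).add_mem (Submodule.smul_mem _ _ (Submodule.sub_mem _ (hH.mul hO)
    (hO.mul hH))) (Submodule.sum_mem _ fun k _ => Submodule.sub_mem _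
      (((hJ k).conjTranspose.mul hO).mul (hJ k)) (Submodule.smul_mem _ _ (Submodule.add_mem _
        ((hJJ k).mul hO) (hO.mul (hJJ k)))))

end Support

/-! ### Lindblad generators are dissipative -/

section Dissipative

variable {E : Type*} [NormedAddCommGroup E] [NormedSpace ℂ E]

/-- `1 + h K` is a contraction up to second order in `h`. -/
def IsDissipative (K : E →L[ℂ] E) : Prop :=
  ∃ c : ℝ, ∀ h : ℝ, 0 ≤ h → ‖1 + (h : ℂ) • K‖ ≤ 1 + c * h ^ 2

theorem isDissipative_zero : IsDissipative (0 : E →L[ℂ] E) :=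
  ⟨0, fun h _ => by
    rw [smul_zero, add_zero, zero_mul, add_zero]
    exact ContinuousLinearMap.norm_id_le⟩

/-- `1 + h (K + K')` is the average of `1 + 2 h K` and `1 + 2 h K'`, so no product formula is
needed. -/
theorem IsDissipative.add {K K' : E →L[ℂ] E} (hK : IsDissipative K) (hK' : IsDissipative K') :
    IsDissipative (K + K') := by
  obtain ⟨c, hc⟩ := hK
  obtain ⟨c', hc'⟩ := hK'
  refine ⟨2 * (c + c'), fun h hh => ?_⟩
  have e : (1 : E →L[ℂ] E) + (h : ℂ) • (K + K') =
      (1 / 2 : ℂ) • ((1 + ((2 * h : ℝ) : ℂ) • K) + (1 + ((2 * h : ℝ) : ℂ) • K')) := by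
    push_cast
    module
  rw [e]
  have h2 : 0 ≤ 2 * h := by positivity
  calc _ ≤ ‖(1 / 2 : ℂ)‖ * (‖1 + ((2 * h : ℝ) : ℂ) • K‖ + ‖1 + ((2 * h : ℝ) : ℂ) • K'‖) := by
        rw [norm_smul]
        gcongr
        exact norm_add_le _ _
    _ ≤ (1 / 2) * ((1 + c * (2 * h) ^ 2) + (1 + c' * (2 * h) ^ 2)) := by
        have : ‖(1 / 2 : ℂ)‖ = 1 / 2 := by norm_num
        rw [this]
        gcongr
        · exact hc _ h2
        · exact hc' _ h2
    _ = 1 + 2 * (c + c') * h ^ 2 := by ring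

theorem IsDissipative.sum {ι : Type*} (s : Finset ι) {K : ι → E →L[ℂ] E}
    (hK : ∀ i ∈ s, IsDissipative (K i)) : IsDissipative (∑ i ∈ s, K i) :=
  Finset.sum_induction _ _ (fun _ _ => IsDissipative.add) isDissipative_zero hK

theorem IsDissipative.norm_exp_apply_le [CompleteSpace E] {K : E →L[ℂ] E} (hK : IsDissipative K)
    {t : ℝ} (ht : 0 ≤ t) (x : E) : ‖NormedSpace.exp ((t : ℂ) • K) x‖ ≤ ‖x‖ := by
  obtain ⟨c, hc⟩ := hK
  simpa using ContinuousLinearMap.le_of_opNorm_le _ (norm_exp_smul_le_one hc ht) x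

end Dissipative

/-- Up to the second-order term `s² Gᴴ O G`, the map `1 + s K` is completely positive, with Kraus
operators `1 + s G` (no jump) and `√s J k`. Its norm is then controlled by its value at `1`, where
`K 1 = 0`. -/
theorem IsAdjointLiouvillianOn.isDissipative {d : ℤ → ℕ} {Λ : Finset ℤ} {S : Finset Λ} {K : SuperOp d Λ}
    (hK : IsAdjointLiouvillianOn S K) : IsDissipative K := by
  obtain ⟨H, n, J, hH, -, -, h⟩ := hK
  set P : Op d Λ := ∑ k, (J k).conjTranspose * J k with hP
  set G : Op d Λ := -(Complex.I • H) - (1 / 2 : ℂ) • P with hG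
  have hPs : P.conjTranspose = P := by
    simp [hP, Matrix.conjTranspose_sum, Matrix.conjTranspose_mul]
  have hGs : G.conjTranspose = Complex.I • H - (1 / 2 : ℂ) • P := by
    rw [hG, Matrix.conjTranspose_sub, Matrix.conjTranspose_neg, Matrix.conjTranspose_smul,
      Matrix.conjTranspose_smul, hPs, hH.eq]
    simp
  have hKO : ∀ O, K O = G.conjTranspose * O + O * G + ∑ k, (J k).conjTranspose * O * J k := by
    intro O
    have e1 : ∑ k, (1 / 2 : ℂ) • ((J k).conjTranspose * J k * O + O * ((J k).conjTranspose * J k)) =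
        (1 / 2 : ℂ) • (P * O + O * P) := by
      rw [← Finset.smul_sum, Finset.sum_add_distrib, hP, Finset.sum_mul, Finset.mul_sum]
    rw [h, adjointLindblad, Finset.sum_sub_distrib, e1, hGs, hG]
    simp only [sub_mul, mul_sub, smul_mul_assoc, mul_smul_comm, mul_neg, smul_sub, smul_add]
    abel
  refine ⟨2 * (‖G‖ * ‖G‖), fun s hs => ContinuousLinearMap.opNorm_le_bound _ (by positivity)
    fun O => ?_⟩
  let V : Option (Fin n) → Op d Λ := fun k =>
    k.elim (1 + (s : ℂ) • G) (fun k => ((Real.sqrt s : ℝ) : ℂ) • J k)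
  have hsq : ((Real.sqrt s : ℝ) : ℂ) * ((Real.sqrt s : ℝ) : ℂ) = s := by
    rw [← Complex.ofReal_mul, Real.mul_self_sqrt hs]
  have hV : ∀ O : Op d Λ, ∑ k, (V k).conjTranspose * O * V k =
      O + (s : ℂ) • K O + ((s : ℂ) * s) • (G.conjTranspose * O * G) := by
    intro O
    have e2 : ∀ k, (((Real.sqrt s : ℝ) : ℂ) • J k).conjTranspose * O *
        (((Real.sqrt s : ℝ) : ℂ) • J k) = (s : ℂ) • ((J k).conjTranspose * O * J k) := by
      intro k
      rw [Matrix.conjTranspose_smul, smul_mul_assoc, smul_mul_assoc, mul_smul_comm, smul_smul,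
        Complex.star_def, Complex.conj_ofReal, hsq]
    rw [Fintype.sum_option]
    simp only [V, Option.elim_none, Option.elim_some, e2]
    rw [← Finset.smul_sum, hKO, Matrix.conjTranspose_add, Matrix.conjTranspose_one,
      Matrix.conjTranspose_smul, Complex.star_def, Complex.conj_ofReal]
    simp only [add_mul, mul_add, one_mul, mul_one, smul_mul_assoc, mul_smul_comm, smul_add,
      smul_smul]
    abel
  have hK1 : K 1 = 0 := by
    rw [hKO, hGs, hG]
    simp only [mul_one, one_mul]
    rw [← hP]
    have : (1 / 2 : ℂ) • P + (1 / 2 : ℂ) • P = P := by module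
    nth_rewrite 3 [← this]
    abel
  have hGG : ∀ O : Op d Λ, ‖((s : ℂ) * s) • (G.conjTranspose * O * G)‖ ≤
      s ^ 2 * (‖G‖ * ‖G‖) * ‖O‖ := by
    intro O
    rw [norm_smul, ← pow_two, norm_pow, Complex.norm_real, Real.norm_of_nonneg hs,
      mul_assoc (s ^ 2)]
    refine mul_le_mul_of_nonneg_left ?_ (by positivity)
    calc ‖G.conjTranspose * O * G‖ ≤ ‖G.conjTranspose‖ * ‖O‖ * ‖G‖ :=
          (Matrix.l2_opNorm_mul _ _).trans
            (mul_le_mul_of_nonneg_right (Matrix.l2_opNorm_mul _ _) (norm_nonneg _))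
      _ = ‖G‖ * ‖G‖ * ‖O‖ := by rw [Matrix.l2_opNorm_conjTranspose]; ring
  have h1 := norm_sum_conjTranspose_mul_mul_le V O
  have h2 : ‖∑ k, (V k).conjTranspose * V k‖ ≤ 1 + s ^ 2 * (‖G‖ * ‖G‖) := by
    have e := hV 1
    simp only [mul_one] at e
    rw [e, hK1, smul_zero, add_zero, ← Matrix.star_eq_conjTranspose]
    have hone : ‖(1 : Op d Λ)‖ ≤ 1 := by
      rw [← Matrix.l2_opNorm_toEuclideanCLM, map_one]
      exact ContinuousLinearMap.norm_id_le
    refine (norm_add_le _ _).trans (add_le_add hone ?_)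
    rw [norm_smul, ← pow_two, norm_pow, Complex.norm_real, Real.norm_of_nonneg hs]
    gcongr
    rw [CStarRing.norm_star_mul_self]
  have h3 : (1 + (s : ℂ) • K) O =
      ∑ k, (V k).conjTranspose * O * V k - ((s : ℂ) * s) • (G.conjTranspose * O * G) := by
    rw [hV, add_sub_cancel_right]
    rfl
  rw [h3]
  calc _ ≤ (1 + s ^ 2 * (‖G‖ * ‖G‖)) * ‖O‖ + s ^ 2 * (‖G‖ * ‖G‖) * ‖O‖ := by
        refine (norm_sub_le _ _).trans (add_le_add (h1.trans ?_) (hGG O))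
        gcongr
    _ = (1 + 2 * (‖G‖ * ‖G‖) * s ^ 2) * ‖O‖ := by ring

/-! ### Fronts, windows and rare events -/

section LocalDynamics

variable {E ι : Type*} [NormedAddCommGroup E] [NormedSpace ℂ E]

/-- A family of closed subspaces `W S` of elements supported on `S ⊆ ι`, and a family of generators
`L Z` acting on at most two sites such that all partial sums generate contraction semigroups. -/
structure LocalDynamics (W : Finset ι → Submodule ℂ E) (L : Finset ι → E →L[ℂ] E) : Prop where
  isClosed : ∀ S, IsClosed (W S : Set E)
  mono : ∀ S T, S ⊆ T → W S ≤ W T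
  apply_mem : ∀ Z S, Z ⊆ S → ∀ x ∈ W S, L Z x ∈ W S
  apply_eq_zero : ∀ Z S, Disjoint Z S → ∀ x ∈ W S, L Z x = 0
  norm_exp_le : ∀ (F : Finset (Finset ι)) (t : ℝ), 0 ≤ t → ∀ x,
    ‖NormedSpace.exp ((t : ℂ) • ∑ Z ∈ F, L Z) x‖ ≤ ‖x‖
  twoBody : ∀ Z : Finset ι, 2 < Z.card → L Z = 0

/-- The sites of `D` at positions beyond `g`. -/
noncomputable def ahead (φ : ι → ℝ) (D : Finset ι) (g : ℝ) : Finset ι :=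
  D.filter fun i => g < φ i

theorem ahead_anti (φ : ι → ℝ) (D : Finset ι) {g g' : ℝ} (h : g ≤ g') :
    ahead φ D g' ⊆ ahead φ D g :=
  Finset.monotone_filter_right _ fun _ _ hi => lt_of_le_of_lt h hi

/-- The total strength of the generators that touch a window of length `l`, coming from the left or
from inside, and whose range exceeds `R`, is at most `lam`. -/
def RateBound (φ : ι → ℝ) (L : Finset ι → E →L[ℂ] E) (l R lam : ℝ) : Prop :=
  ∀ (c : ℝ) (G : Finset (Finset ι)),
    (∀ Z ∈ G, ∃ i ∈ Z, ∃ j ∈ Z, φ i ≤ c + l ∧ c < φ j ∧ R < φ j - φ i) → ∑ Z ∈ G, ‖L Z‖ ≤ lam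

/-- If only generators of range at most `R` touch the window `(c, c + l]`, then up to times `τ` the
weight that reaches the last `R` sites of this window is at most `p`. The sites outside `D` are
decoupled spectators. -/
def WindowBound [Fintype ι] [DecidableEq ι] (φ : ι → ℝ) (W : Finset ι → Submodule ℂ E) (L : Finset ι → E →L[ℂ] E)
    (l R τ p : ℝ) : Prop :=
  ∀ (F : Finset (Finset ι)) (D : Finset ι) (c : ℝ) (x : E) (K : E →L[ℂ] E) (t : ℝ),
    (∀ Z ∈ F, Z ⊆ D ∨ Disjoint Z D) →
    (∀ Z ∈ F, ∀ i ∈ Z, ∀ j ∈ Z, i ∈ D → j ∈ D → φ i ≤ c + l → c < φ j → φ j - φ i ≤ R) →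
    x ∈ W (ahead φ D c)ᶜ → (∀ y ∈ W (ahead φ D (c + l - R))ᶜ, K y = 0) → 0 ≤ t → t ≤ τ →
    ‖K (NormedSpace.exp ((t : ℂ) • ∑ Z ∈ F, L Z) x)‖ ≤ p * ‖K‖ * ‖x‖

variable {φ : ι → ℝ} {W : Finset ι → Submodule ℂ E} {L : Finset ι → E →L[ℂ] E}

theorem RateBound.nonneg {l R lam : ℝ} (h : RateBound φ L l R lam) : 0 ≤ lam := by
  simpa using h 0 ∅ (by simp)

theorem LocalDynamics.exp_mem [CompleteSpace E] (hL : LocalDynamics W L) {S : Finset ι} {F : Finset (Finset ι)}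
    (hF : ∀ Z ∈ F, Z ⊆ S ∨ Disjoint Z S) (z : ℂ) {x : E} (hx : x ∈ W S) :
    NormedSpace.exp (z • ∑ Z ∈ F, L Z) x ∈ W S := by
  refine exp_smul_apply_mem (hL.isClosed S) (fun y hy => ?_) z hx
  rw [sum_apply]
  refine (W S).sum_mem fun Z hZ => ?_
  rcases hF Z hZ with h | h
  · exact hL.apply_mem Z S h y hy
  · rw [hL.apply_eq_zero Z S h y hy]
    exact (W S).zero_mem

/-- No term inside `D` straddles the cut `g`, so every term is either inside or disjoint from the
complement of `ahead φ D g`, which also contains the spectators. -/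
theorem LocalDynamics.exp_mem_ahead [CompleteSpace E] [Fintype ι] [DecidableEq ι]
    (hL : LocalDynamics W L) {D : Finset ι} {F : Finset (Finset ι)} {g : ℝ} (hD : ∀ Z ∈ F, Z ⊆ D ∨ Disjoint Z D)
    (hF : ∀ Z ∈ F, ∀ i ∈ Z, ∀ j ∈ Z, i ∈ D → j ∈ D → φ i ≤ g → φ j ≤ g) (z : ℂ) {x : E}
    (hx : x ∈ W (ahead φ D g)ᶜ) :
    NormedSpace.exp (z • ∑ Z ∈ F, L Z) x ∈ W (ahead φ D g)ᶜ := by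
  refine hL.exp_mem (fun Z hZ => ?_) z hx
  rw [Finset.subset_compl_iff_disjoint_right, disjoint_compl_right_iff]
  rcases hD Z hZ with h | h
  · by_cases h' : ∃ i ∈ Z, φ i ≤ g
    · obtain ⟨i, hi, hig⟩ := h'
      left
      rw [Finset.disjoint_left]
      intro j hj hj'
      exact absurd (Finset.mem_filter.1 hj').2 (not_lt.2 (hF Z hZ i hi j hj (h hi) (h hj) hig))
    · push Not at h'
      exact Or.inr fun i hi => Finset.mem_filter.2 ⟨h hi, h' i hi⟩
  · exact Or.inl (h.mono_right (Finset.filter_subset _ _))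

/-- Duhamel's formula when the generators in `F \ F'` are removed during the time `[0, τ]`. -/
theorem LocalDynamics.norm_apply_exp_le [CompleteSpace E] [DecidableEq ι] (K : E →L[ℂ] E)
    {F F' : Finset (Finset ι)} (hF : F' ⊆ F) (x : E) {T τ B C : ℝ} (hτ : 0 ≤ τ) (hB0 : 0 ≤ B)
    (hB : ∀ s, 0 ≤ s → s ≤ τ → ∀ Z ∈ F \ F',
      ‖K (NormedSpace.exp (((T - s : ℝ) : ℂ) • ∑ Z ∈ F, L Z)
        (L Z (NormedSpace.exp ((s : ℂ) • ∑ Z ∈ F', L Z) x)))‖ ≤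
        B * ‖L Z (NormedSpace.exp ((s : ℂ) • ∑ Z ∈ F', L Z) x)‖)
    (hC : ∀ s, 0 ≤ s → s ≤ τ →
      ∑ Z ∈ F \ F', ‖L Z (NormedSpace.exp ((s : ℂ) • ∑ Z ∈ F', L Z) x)‖ ≤ C) :
    ‖K (NormedSpace.exp ((T : ℂ) • ∑ Z ∈ F, L Z) x)‖ ≤
      ‖K (NormedSpace.exp (((T - τ : ℝ) : ℂ) • ∑ Z ∈ F, L Z)
        (NormedSpace.exp ((τ : ℂ) • ∑ Z ∈ F', L Z) x))‖ + B * C * τ := by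
  refine norm_exp_apply_le_add K _ _ x hτ fun s hs hsτ => ?_
  rw [← Finset.sum_sdiff hF, add_sub_cancel_right, sum_apply, map_sum, map_sum,
    Finset.sum_sdiff hF]
  refine (norm_sum_le _ _).trans ((Finset.sum_le_sum fun Z hZ => hB s hs hsτ Z hZ).trans ?_)
  rw [← Finset.mul_sum]
  exact mul_le_mul_of_nonneg_left (hC s hs hsτ) hB0

/-- The rate at which the removed generators act. -/
theorem LocalDynamics.sum_norm_apply_le [Fintype ι] [DecidableEq ι]
    (hL : LocalDynamics W L) {l R τ p lam J : ℝ} (hp : 0 ≤ p) (hW : WindowBound φ W L l R τ p) (hlam : RateBound φ L l R lam) (hJ : RateBound φ L 0 0 J)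
    {F G : Finset (Finset ι)} {D : Finset ι} {c : ℝ} {x : E} {s : ℝ}
    (hD : ∀ Z ∈ F, Z ⊆ D ∨ Disjoint Z D)
    (hF : ∀ Z ∈ F, ∀ i ∈ Z, ∀ j ∈ Z, i ∈ D → j ∈ D → φ i ≤ c + l → c < φ j → φ j - φ i ≤ R)
    (hx : x ∈ W (ahead φ D c)ᶜ) (hs : 0 ≤ s) (hsτ : s ≤ τ)
    (hG : ∀ Z ∈ G, (∃ i ∈ Z, ∃ j ∈ Z, φ i ≤ c + l ∧ c < φ j ∧ R < φ j - φ i) ∨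
      ∃ i ∈ Z, ∃ j ∈ Z, i ∈ D ∧ j ∈ D ∧ φ i ≤ c + l ∧ c + l < φ j ∧ φ j - φ i ≤ R) :
    ∑ Z ∈ G, ‖L Z (NormedSpace.exp ((s : ℂ) • ∑ Z ∈ F, L Z) x)‖ ≤ (lam + p * J) * ‖x‖ := by
  classical
  set y := NormedSpace.exp ((s : ℂ) • ∑ Z ∈ F, L Z) x with hy
  have hyx : ‖y‖ ≤ ‖x‖ := hL.norm_exp_le F s hs x
  rw [← Finset.sum_filter_add_sum_filter_not G
    (fun Z => ∃ i ∈ Z, ∃ j ∈ Z, φ i ≤ c + l ∧ c < φ j ∧ R < φ j - φ i), add_mul]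
  refine add_le_add ?_ ?_
  · refine le_trans (Finset.sum_le_sum fun Z _ => ((L Z).le_opNorm y).trans
      (mul_le_mul_of_nonneg_left hyx (norm_nonneg _))) ?_
    rw [← Finset.sum_mul]
    exact mul_le_mul_of_nonneg_right
      (hlam c _ fun Z hZ => (Finset.mem_filter.1 hZ).2) (norm_nonneg _)
  · have hcross : ∀ Z ∈ G.filter (fun Z => ¬ ∃ i ∈ Z, ∃ j ∈ Z, φ i ≤ c + l ∧ c < φ j ∧
        R < φ j - φ i), ∃ i ∈ Z, ∃ j ∈ Z, i ∈ D ∧ j ∈ D ∧ φ i ≤ c + l ∧ c + l < φ j ∧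
          φ j - φ i ≤ R := fun Z hZ =>
      (hG Z (Finset.mem_filter.1 hZ).1).resolve_left (Finset.mem_filter.1 hZ).2
    have hterm : ∀ Z ∈ G.filter (fun Z => ¬ ∃ i ∈ Z, ∃ j ∈ Z, φ i ≤ c + l ∧ c < φ j ∧
        R < φ j - φ i), ‖L Z y‖ ≤ ‖L Z‖ * (p * ‖x‖) := by
      intro Z hZ
      obtain ⟨i, hi, j, hj, hiD, hjD, hil, hjl, hij⟩ := hcross Z hZ
      by_cases hcard : 2 < Z.card
      · rw [hL.twoBody Z hcard]
        simp
      · have hne : i ≠ j := fun h => by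
          rw [h] at hil
          exact absurd hjl (not_lt.2 hil)
        -- The two-body assumption enters here: a term of range at most `R` across `c + l` has no
        -- further sites, so all of it lies beyond `c + l - R` and `L Z` itself can serve as the
        -- observer in `hW`.
        have hZe : Z = {i, j} := by
          refine (Finset.eq_of_subset_of_card_le ?_ ?_).symm
          · intro k hk
            rcases Finset.mem_insert.1 hk with rfl | hk
            · exact hi
            · rw [Finset.mem_singleton.1 hk]; exact hj
          · rw [Finset.card_pair hne]; omega
        have hZa : Z ⊆ ahead φ D (c + l - R) := by
          intro k hk
          rw [hZe] at hk
          rcases Finset.mem_insert.1 hk with rfl | hk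
          · exact Finset.mem_filter.2 ⟨hiD, by linarith⟩
          · rw [Finset.mem_singleton.1 hk]
            exact Finset.mem_filter.2 ⟨hjD, by linarith⟩
        have := hW F D c x (L Z) s hD hF hx (fun w hw => hL.apply_eq_zero Z _
          (disjoint_compl_right.mono_left hZa) w hw) hs hsτ
        calc ‖L Z y‖ ≤ p * ‖L Z‖ * ‖x‖ := this
          _ = ‖L Z‖ * (p * ‖x‖) := by ring
    refine (Finset.sum_le_sum hterm).trans ?_
    rw [← Finset.sum_mul]
    calc _ ≤ J * (p * ‖x‖) := by
          -- A window of length zero: `J` bounds the total strength across a single cut.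
          refine mul_le_mul_of_nonneg_right (hJ (c + l) _ fun Z hZ => ?_) (by positivity)
          obtain ⟨i, hi, j, hj, -, -, hil, hjl, -⟩ := hcross Z hZ
          exact ⟨i, hi, j, hj, by linarith, hjl, by linarith⟩
      _ = p * J * ‖x‖ := by ring

/-- With range zero nothing crosses the cut `c + l`, so the observer sees nothing, for any `τ` and
`p`. This is the base of the induction on scales. -/
theorem WindowBound.of_range_zero [CompleteSpace E] [Fintype ι] [DecidableEq ι]
    (hL : LocalDynamics W L) {l τ p : ℝ} (hl : 0 ≤ l) (hp : 0 ≤ p) :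
    WindowBound φ W L l 0 τ p := by
  intro F D c x K t hD hF hx hK _ _
  rw [hK, norm_zero]
  · positivity
  · rw [sub_zero]
    refine hL.exp_mem_ahead hD (fun Z hZ i hi j hj hiD hjD hil => ?_) _
      (hL.mono _ _ (Finset.compl_subset_compl.2 (ahead_anti φ D (by linarith))) hx)
    by_contra hjl
    have := hF Z hZ i hi j hj hiD hjD hil (by linarith)
    linarith

/-- Propagation over a distance much larger than the window size `l`: the front advances by `l`
during each time `τ`, except for `m` rare events, each of which costs a factor `μ T`. -/
theorem WindowBound.step [CompleteSpace E] [Fintype ι] [DecidableEq ι]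
    (hL : LocalDynamics W L) {l R τ p lam J μ : ℝ} (hl : 0 ≤ l) (hτ : 0 < τ)
    (hp : 0 ≤ p) (hW : WindowBound φ W L l R τ p) (hlam : RateBound φ L l R lam)
    (hJ : RateBound φ L 0 0 J) (hμ : lam + p * J ≤ μ) {l' T' : ℝ} {m N : ℕ} (hT' : T' ≤ N * τ)
    (hl' : ((N : ℝ) + 2 * m) * l ≤ l' - l) : WindowBound φ W L l' l T' ((μ * T') ^ m) := by
  classical
  intro F D c x K t hD hF hx hK ht htT
  have hμ0 : 0 ≤ μ := le_trans (add_nonneg hlam.nonneg (mul_nonneg hp hJ.nonneg)) hμ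
  -- `c₁` is the current front, `N` the time steps left and `m` the rare events still counted. A
  -- time step costs one window and an event two. With `m = 0` contractivity suffices; with `N = 0`
  -- no time is left and the front has not reached the observer.
  have main : ∀ (m N : ℕ) (c₁ T : ℝ) (x : E), c ≤ c₁ → c₁ + ((N : ℝ) + 2 * m) * l ≤ c + l' - l →
      x ∈ W (ahead φ D c₁)ᶜ → 0 ≤ T → T ≤ N * τ →
      ‖K (NormedSpace.exp ((T : ℂ) • ∑ Z ∈ F, L Z) x)‖ ≤ (μ * T) ^ m * ‖K‖ * ‖x‖ := by
    intro m
    induction m with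
    | zero =>
      intro N c₁ T x _ _ _ hT _
      rw [pow_zero, one_mul]
      exact (K.le_opNorm _).trans
        (mul_le_mul_of_nonneg_left (hL.norm_exp_le F T hT x) (norm_nonneg _))
    | succ m ihm =>
      intro N
      induction N with
      | zero =>
        intro c₁ T x _ hg hx hT hTN
        have hT0 : T = 0 := le_antisymm (by simpa using hTN) hT
        have hge : c₁ ≤ c + l' - l := by
          refine le_trans (le_add_of_nonneg_right ?_) hg
          positivity
        have : K x = 0 :=
          hK x (hL.mono _ _ (Finset.compl_subset_compl.2 (ahead_anti φ D hge)) hx)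
        rw [hT0, Complex.ofReal_zero, zero_smul, NormedSpace.exp_zero]
        change ‖K x‖ ≤ _
        rw [this, norm_zero]
        positivity
      | succ N ihN =>
        intro c₁ T x hc hg hx hT hTN
        push_cast at hg hTN
        have hml : 0 ≤ (m : ℝ) * l := by positivity
        have hNl : 0 ≤ (N : ℝ) * l := by positivity
        have hge : c₁ + l ≤ c + l' - l := by nlinarith
        -- Terms touching the current window that are too long for the bound `hW`, or that cross its
        -- far end.
        let del : Finset ι → Prop := fun Z => ∃ i ∈ Z, ∃ j ∈ Z, i ∈ D ∧ j ∈ D ∧ φ i ≤ c₁ + l ∧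
          c₁ < φ j ∧ (R < φ j - φ i ∨ c₁ + l < φ j)
        set F' := F.filter (fun Z => ¬ del Z) with hF'
        have hsub : F' ⊆ F := Finset.filter_subset _ _
        have hD' : ∀ Z ∈ F', Z ⊆ D ∨ Disjoint Z D := fun Z hZ => hD Z (hsub hZ)
        have hmem : ∀ s : ℝ, NormedSpace.exp ((s : ℂ) • ∑ Z ∈ F', L Z) x ∈
            W (ahead φ D (c₁ + l))ᶜ := by
          intro s
          refine hL.exp_mem_ahead hD' (fun Z hZ i hi j hj hiD hjD hil => ?_) _
            (hL.mono _ _ (Finset.compl_subset_compl.2 (ahead_anti φ D (by linarith))) hx)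
          by_contra hjl
          push Not at hjl
          exact (Finset.mem_filter.1 hZ).2
            ⟨i, hi, j, hj, hiD, hjD, hil, by linarith, Or.inr hjl⟩
        have hdel : ∀ Z ∈ F \ F', del Z := by
          intro Z hZ
          rw [Finset.mem_sdiff] at hZ
          by_contra h
          exact hZ.2 (Finset.mem_filter.2 ⟨hZ.1, h⟩)
        set σ := min τ T with hσ
        have hσ0 : 0 ≤ σ := le_min hτ.le hT
        have hστ : σ ≤ τ := min_le_left _ _
        have hσT : σ ≤ T := min_le_right _ _
        have hB0 : 0 ≤ (μ * T) ^ m * ‖K‖ := by positivity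
        have h1 := LocalDynamics.norm_apply_exp_le (L := L) K hsub x (T := T) (τ := σ)
          (B := (μ * T) ^ m * ‖K‖) (C := μ * ‖x‖) hσ0 hB0 ?_ ?_
        · refine h1.trans ?_
          have h2 := ihN (c₁ + l) (T - σ) (NormedSpace.exp ((σ : ℂ) • ∑ Z ∈ F', L Z) x)
            (by linarith) (by push_cast; linarith) (hmem σ) (by linarith) (by
              rcases min_choice τ T with h | h
              · rw [hσ, h]; linarith
              · rw [hσ, h, sub_self]; positivity)
          have h3 := hL.norm_exp_le F' σ hσ0 x
          calc _ ≤ (μ * (T - σ)) ^ (m + 1) * ‖K‖ * ‖x‖ + (μ * T) ^ m * ‖K‖ * (μ * ‖x‖) * σ := by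
                refine add_le_add (h2.trans ?_) le_rfl
                have : 0 ≤ μ * (T - σ) := mul_nonneg hμ0 (by linarith)
                gcongr
            _ ≤ (μ * T) ^ m * (μ * (T - σ)) * ‖K‖ * ‖x‖ + (μ * T) ^ m * ‖K‖ * (μ * ‖x‖) * σ := by
                have h0 : 0 ≤ T - σ := by linarith
                rw [pow_succ]
                gcongr
                linarith
            _ = (μ * T) ^ (m + 1) * ‖K‖ * ‖x‖ := by ring
        · intro s hs hsσ Z hZ
          have hZF := (Finset.mem_sdiff.1 hZ).1
          have h0 : 0 ≤ T - s := by linarith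
          -- The event starts from a front at `c₁ + l` and has range at most `l`, so it reaches at
          -- most `c₁ + 2 l`. The elapsed time `s` may be zero, so all `N + 1` time steps are kept.
          have h2 := ihm (N + 1) (c₁ + 2 * l) (T - s)
            (L Z (NormedSpace.exp ((s : ℂ) • ∑ Z ∈ F', L Z) x)) (by linarith)
            (by push_cast; linarith) ?_ h0 (by push_cast; linarith)
          · refine h2.trans ?_
            gcongr
            linarith
          · refine hL.apply_mem Z _ ?_ _ (hL.mono _ _ (Finset.compl_subset_compl.2
              (ahead_anti φ D (by linarith))) (hmem s))
            intro k hk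
            rw [Finset.mem_compl]
            intro hk'
            obtain ⟨hkD, hkl⟩ := Finset.mem_filter.1 hk'
            obtain ⟨i, hi, j, hj, hiD, hjD, hil, -⟩ := hdel Z hZ
            have := hF Z hZF i hi k hk hiD hkD (by linarith) (by linarith)
            linarith
        · intro s hs hsσ
          refine (hL.sum_norm_apply_le hp hW hlam hJ (c := c₁) hD' ?_ hx hs (hsσ.trans hστ)
            ?_).trans (mul_le_mul_of_nonneg_right hμ (norm_nonneg _))
          · intro Z hZ i hi j hj hiD hjD hil hjc
            by_contra hR
            push Not at hR
            exact (Finset.mem_filter.1 hZ).2 ⟨i, hi, j, hj, hiD, hjD, hil, hjc, Or.inl hR⟩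
          · intro Z hZ
            obtain ⟨i, hi, j, hj, hiD, hjD, hil, hjc, h⟩ := hdel Z hZ
            by_cases hR : R < φ j - φ i
            · exact Or.inl ⟨i, hi, j, hj, hil, hjc, hR⟩
            · exact Or.inr ⟨i, hi, j, hj, hiD, hjD, hil, h.resolve_left hR, not_lt.1 hR⟩
  have htN : t ≤ N * τ := htT.trans hT'
  refine (main m N c t x le_rfl (by linarith) hx ht htN).trans ?_
  gcongr

end LocalDynamics

/-! ### Total strength of long-range terms -/

theorem Finset.sum_biUnion_le_sum_sum {κ ι : Type*} [DecidableEq ι] (s : Finset κ)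
    (t : κ → Finset ι) {f : ι → ℝ} (hf : ∀ i, 0 ≤ f i) :
    ∑ i ∈ s.biUnion t, f i ≤ ∑ k ∈ s, ∑ i ∈ t k, f i := by
  classical
  induction s using Finset.induction_on with
  | empty => simp
  | insert k s hk ih =>
    rw [Finset.biUnion_insert, Finset.sum_insert hk]
    have h := Finset.sum_union_inter (s₁ := t k) (s₂ := s.biUnion t) (f := f)
    have h0 : 0 ≤ ∑ i ∈ t k ∩ s.biUnion t, f i := Finset.sum_nonneg fun i _ => hf i
    linarith

/-- Power-law decay with an exponent `α` controls the strength of the long-range terms. -/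
theorem rateBound_of_decay {E ι : Type*} [NormedAddCommGroup E] [NormedSpace ℂ E] [Fintype ι]
    [DecidableEq ι] {φ : ι → ℤ} (hφ : Function.Injective φ) {L : Finset ι → E →L[ℂ] E} {α : ℝ}
    (hdec : ∀ i j, i ≠ j →
      ∑ Z with i ∈ Z ∧ j ∈ Z, ‖L Z‖ ≤ 1 / |(φ i : ℝ) - (φ j : ℝ)| ^ α)
    {l R A β : ℝ} (hR : 0 ≤ R) (hβ : 1 < β) (hA0 : 0 ≤ A)
    (hA : ∀ n : ℕ, 1 ≤ n → R < n → (n : ℝ) + l + 1 ≤ A * (n : ℝ) ^ (α - β)) :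
    RateBound (fun i => (φ i : ℝ)) L l R (A * ∑' n : ℕ, 1 / (n : ℝ) ^ β) := by
  classical
  intro c G hG
  set P : Finset (ι × ι) := Finset.univ.filter fun p =>
    (φ p.1 : ℝ) ≤ c + l ∧ c < φ p.2 ∧ R < (φ p.2 : ℝ) - φ p.1 with hP
  let q : ι × ι → ℕ := fun p => (φ p.2 - φ p.1).toNat
  have hq : ∀ p ∈ P, ((q p : ℕ) : ℝ) = (φ p.2 : ℝ) - φ p.1 := by
    intro p hp
    have h := (Finset.mem_filter.1 hp).2.2.2
    have h0 : (0 : ℤ) ≤ φ p.2 - φ p.1 := by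
      have : (0 : ℝ) ≤ ((φ p.2 - φ p.1 : ℤ) : ℝ) := by push_cast; linarith
      exact_mod_cast this
    have : ((q p : ℕ) : ℤ) = φ p.2 - φ p.1 := Int.toNat_of_nonneg h0
    have h2 : (((q p : ℕ) : ℤ) : ℝ) = ((φ p.2 - φ p.1 : ℤ) : ℝ) := by rw [this]
    push_cast at h2
    exact h2
  have hsub : G ⊆ P.biUnion fun p => Finset.univ.filter fun Z => p.1 ∈ Z ∧ p.2 ∈ Z := by
    intro Z hZ
    obtain ⟨i, hi, j, hj, h⟩ := hG Z hZ
    exact Finset.mem_biUnion.2 ⟨(i, j), Finset.mem_filter.2 ⟨Finset.mem_univ _, h⟩,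
      Finset.mem_filter.2 ⟨Finset.mem_univ _, hi, hj⟩⟩
  have h1 : ∑ Z ∈ G, ‖L Z‖ ≤ ∑ p ∈ P, 1 / ((q p : ℕ) : ℝ) ^ α := by
    refine (Finset.sum_le_sum_of_subset_of_nonneg hsub fun _ _ _ => norm_nonneg _).trans ?_
    refine (Finset.sum_biUnion_le_sum_sum _ _ fun _ => norm_nonneg _).trans ?_
    refine Finset.sum_le_sum fun p hp => ?_
    have h := (Finset.mem_filter.1 hp).2.2.2
    have hne : p.1 ≠ p.2 := fun h' => by rw [h'] at h; linarith
    refine (hdec p.1 p.2 hne).trans (le_of_eq ?_)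
    rw [hq p hp, abs_sub_comm, abs_of_pos (by linarith)]
  -- A pair at distance `n` is determined by its left site, which lies in `(c - n, c + l]`.
  have hcard : ∀ n ∈ P.image q, ((P.filter fun p => q p = n).card : ℝ) ≤ n + l + 1 := by
    intro n hn
    obtain ⟨p₀, hp₀, hp₀n⟩ := Finset.mem_image.1 hn
    have hle : (P.filter fun p => q p = n).card ≤ (Finset.Ioc ⌊c - n⌋ ⌊c + l⌋).card := by
      refine Finset.card_le_card_of_injOn (fun p => φ p.1) (fun p hp => ?_) ?_
      · obtain ⟨hpP, hpn⟩ := Finset.mem_filter.1 hp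
        have h := (Finset.mem_filter.1 hpP).2
        have hqp := hq p hpP
        rw [hpn] at hqp
        rw [Finset.mem_coe, Finset.mem_Ioc, Int.floor_lt, Int.le_floor]
        exact ⟨by linarith [h.2.1], h.1⟩
      · intro p hp p' hp' h
        obtain ⟨hpP, hpn⟩ := Finset.mem_filter.1 hp
        obtain ⟨hpP', hpn'⟩ := Finset.mem_filter.1 hp'
        have h1 := hq p hpP
        have h2 := hq p' hpP'
        have h' : φ p.1 = φ p'.1 := h
        rw [hpn] at h1
        rw [hpn', h1, h'] at h2
        have h3 : φ p.2 = φ p'.2 := by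
          have : (φ p.2 : ℝ) = φ p'.2 := by linarith
          exact_mod_cast this
        exact Prod.ext (hφ h') (hφ h3)
    rw [Int.card_Ioc] at hle
    have h2 : (⌊c - n⌋ : ℝ) ≤ ⌊c + l⌋ := by
      have h := (Finset.mem_filter.1 hp₀).2
      have hqp := hq p₀ hp₀
      rw [hp₀n] at hqp
      have : ⌊c - n⌋ ≤ ⌊c + l⌋ := Int.floor_le_floor (by linarith [h.1, h.2.1])
      exact_mod_cast this
    have h3 : (((⌊c + l⌋ - ⌊c - n⌋).toNat : ℕ) : ℝ) = ⌊c + l⌋ - ⌊c - n⌋ := by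
      have h0 : (0 : ℤ) ≤ ⌊c + l⌋ - ⌊c - n⌋ := by
        have : (⌊c - n⌋ : ℤ) ≤ ⌊c + l⌋ := by exact_mod_cast h2
        omega
      have h4 : ((((⌊c + l⌋ - ⌊c - n⌋).toNat : ℕ) : ℤ) : ℝ) = ((⌊c + l⌋ - ⌊c - n⌋ : ℤ) : ℝ) := by
        rw [Int.toNat_of_nonneg h0]
      push_cast at h4
      exact h4
    calc ((P.filter fun p => q p = n).card : ℝ) ≤ (((⌊c + l⌋ - ⌊c - n⌋).toNat : ℕ) : ℝ) := by
          exact_mod_cast hle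
      _ ≤ n + l + 1 := by
          rw [h3]
          linarith [Int.floor_le (c + l), Int.lt_floor_add_one (c - n)]
  refine h1.trans ?_
  rw [Finset.sum_comp (fun n : ℕ => 1 / (n : ℝ) ^ α) q]
  calc ∑ n ∈ P.image q, (P.filter fun p => q p = n).card • (1 / (n : ℝ) ^ α)
      ≤ ∑ n ∈ P.image q, A * (1 / (n : ℝ) ^ β) := by
        refine Finset.sum_le_sum fun n hn => ?_
        obtain ⟨p, hp, hpn⟩ := Finset.mem_image.1 hn
        have h := (Finset.mem_filter.1 hp).2.2.2
        have hRn : R < n := by rw [← hpn, hq p hp]; exact h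
        have hn0 : (0 : ℝ) < n := by linarith
        have hn1 : 1 ≤ n := by exact_mod_cast hn0
        rw [nsmul_eq_mul]
        calc _ ≤ A * (n : ℝ) ^ (α - β) * (1 / (n : ℝ) ^ α) := by
              gcongr
              exact (hcard n hn).trans (hA n hn1 hRn)
          _ = A * (1 / (n : ℝ) ^ β) := by
              rw [Real.rpow_sub hn0]
              have := (Real.rpow_pos_of_pos hn0 α).ne'
              have := (Real.rpow_pos_of_pos hn0 β).ne'
              field_simp
    _ = A * ∑ n ∈ P.image q, 1 / (n : ℝ) ^ β := by rw [Finset.mul_sum]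
    _ ≤ A * ∑' n : ℕ, 1 / (n : ℝ) ^ β := by
        gcongr
        exact (Real.summable_one_div_nat_rpow.2 hβ).sum_le_tsum _ fun _ _ => by positivity

/-! ### Scales and exponents -/

/-- Parameters of the multiscale argument: windows of length `l` are analysed with terms of range
at most `l ^ (1 - η)`, the weight that crosses them too fast is at most `l ^ (-a)`, and a scale fails
only after `m` rare events. -/
structure ScaleParams (α η a : ℝ) (m : ℕ) (l₀ : ℝ) : Prop where
  three_lt : 3 < α
  pos : 0 < η
  lt_one : η < 1
  two_le : 2 ≤ α - η
  a_eq : a = (1 - η) * (α - 2 - η) - η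
  one_lt : 1 < a * (1 - η)
  le_m : a ≤ m * (a * (1 - η) - 1)
  one_le : 1 ≤ l₀
  le_rpow : ∀ l : ℝ, l₀ ≤ l → 4 * (m : ℝ) + 5 ≤ l ^ (η ^ 2)

/-- Since `a = α - 2 - O(η)`, a small `η` gives `a (1 - η) > 1`, thanks to `α > 3`. Then `m` is
chosen large, and `l₀` last. -/
theorem exists_scaleParams {α ε : ℝ} (hα : 3 < α) (hε : 0 < ε) :
    ∃ (η a : ℝ) (m : ℕ) (l₀ : ℝ), ScaleParams α η a m l₀ ∧ α - 2 - ε ≤ a := by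
  obtain ⟨η, hη, hηε, hηα⟩ : ∃ η : ℝ, 0 < η ∧ η * (2 * α) ≤ ε ∧ η * (2 * α) ≤ α - 3 := by
    refine ⟨min ε (α - 3) / (2 * α), div_pos (lt_min hε (by linarith)) (by linarith), ?_, ?_⟩
    · rw [div_mul_cancel₀ _ (by linarith)]
      exact min_le_left _ _
    · rw [div_mul_cancel₀ _ (by linarith)]
      exact min_le_right _ _
  have hη1 : η < 1 := by nlinarith
  set a := (1 - η) * (α - 2 - η) - η with ha
  have ha1 : a ≥ α - 2 - η * α := by nlinarith
  have hone : 1 < a * (1 - η) := by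
    have : (α - 2 - η * α) * (1 - η) ≤ a * (1 - η) :=
      mul_le_mul_of_nonneg_right ha1 (by linarith)
    nlinarith [mul_pos hη hη]
  obtain ⟨m, hm⟩ := exists_nat_ge (a / (a * (1 - η) - 1))
  rw [div_le_iff₀ (by linarith)] at hm
  have hlim := tendsto_rpow_atTop (show 0 < η ^ 2 by positivity)
  obtain ⟨l₁, hl₁⟩ := Filter.eventually_atTop.1 (hlim.eventually_ge_atTop (4 * (m : ℝ) + 5))
  refine ⟨η, a, m, max l₁ 1, ⟨hα, hη, hη1, by nlinarith, ha, hone, hm, le_max_right _ _,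
    fun l hl => hl₁ l ((le_max_left _ _).trans hl)⟩, by nlinarith⟩

/-- The range of the terms that are retained at scale `l`. -/
noncomputable def scaleRange (η l₀ l : ℝ) : ℝ := if l < l₀ then 0 else l ^ (1 - η)

/-- The time that the front needs to advance by `l`. -/
noncomputable def scaleTime (η v l : ℝ) : ℝ := l * (1 + l ^ (-η)) / v

/-- The constant in the bound on the rate of rare events. -/
noncomputable def rateConst (η a l₀ : ℝ) : ℝ :=
  (5 + (l₀ + 2) * l₀ ^ a) * (1 + ∑' n : ℕ, 1 / (n : ℝ) ^ (1 + η))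

namespace ScaleParams

variable {α η a l₀ : ℝ} {m : ℕ}

theorem a_pos (h : ScaleParams α η a m l₀) : 0 < a := by
  have := h.one_lt
  have := h.lt_one
  by_contra h'
  nlinarith

theorem scaleRange_nonneg {l : ℝ} (hl : 0 ≤ l) : 0 ≤ scaleRange η l₀ l := by
  unfold scaleRange
  split_ifs
  · exact le_rfl
  · positivity

/-- For `n > l ^ (1 - η)` the left side is at most `3 n l ^ η`, and `a` is defined so that `l ^ η =
l ^ (-a) * (l ^ (1 - η)) ^ (α - 2 - η)`. Below `l₀` the factor `l ^ (-a)` is bounded below, which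
accounts for `(l₀ + 2) * l₀ ^ a`. -/
theorem add_one_le (h : ScaleParams α η a m l₀) {l : ℝ} (hl : 0 < l) {n : ℕ} (hn : 1 ≤ n)
    (hln : scaleRange η l₀ l < n) :
    (n : ℝ) + l + 1 ≤ (3 + (l₀ + 2) * l₀ ^ a) * l ^ (-a) * (n : ℝ) ^ (α - (1 + η)) := by
  have hn1 : (1 : ℝ) ≤ n := by exact_mod_cast hn
  have hn0 : (0 : ℝ) < n := by linarith
  have hl₀ := h.one_le
  have hpos : 0 ≤ l ^ (-a) * (n : ℝ) ^ (α - (1 + η)) := by positivity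
  have hpa : 0 ≤ (l₀ + 2) * l₀ ^ a := by positivity
  unfold scaleRange at hln
  split_ifs at hln with hll
  · have h1 : (1 : ℝ) ≤ l₀ ^ a * l ^ (-a) := by
      rw [Real.rpow_neg hl.le, ← div_eq_mul_inv, one_le_div (by positivity)]
      exact Real.rpow_le_rpow hl.le hll.le h.a_pos.le
    have h2 : (n : ℝ) ≤ (n : ℝ) ^ (α - (1 + η)) := by
      calc (n : ℝ) = (n : ℝ) ^ (1 : ℝ) := (Real.rpow_one _).symm
        _ ≤ _ := Real.rpow_le_rpow_of_exponent_le hn1 (by linarith [h.two_le])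
    calc (n : ℝ) + l + 1 ≤ (l₀ + 2) * n := by nlinarith
      _ ≤ (l₀ + 2) * ((l₀ ^ a * l ^ (-a)) * (n : ℝ) ^ (α - (1 + η))) := by
          gcongr
          calc (n : ℝ) ≤ 1 * (n : ℝ) ^ (α - (1 + η)) := by rwa [one_mul]
            _ ≤ _ := by gcongr
      _ = (l₀ + 2) * l₀ ^ a * (l ^ (-a) * (n : ℝ) ^ (α - (1 + η))) := by ring
      _ ≤ (3 + (l₀ + 2) * l₀ ^ a) * (l ^ (-a) * (n : ℝ) ^ (α - (1 + η))) := by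
          gcongr
          linarith
      _ = _ := by ring
  · have hl1 : 1 ≤ l := hl₀.trans (not_lt.1 hll)
    have hlη : 1 ≤ l ^ η := Real.one_le_rpow hl1 h.pos.le
    have h1 : l = l ^ (1 - η) * l ^ η := by
      rw [← Real.rpow_add hl]; simp
    have h2 : l ≤ n * l ^ η := by
      calc l = l ^ (1 - η) * l ^ η := h1
        _ ≤ n * l ^ η := by gcongr
    have h3 : (l ^ (1 - η)) ^ (α - 2 - η) ≤ (n : ℝ) ^ (α - 2 - η) :=
      Real.rpow_le_rpow (by positivity) hln.le (by linarith [h.three_lt, h.lt_one])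
    have h4 : l ^ η = l ^ (-a) * (l ^ (1 - η)) ^ (α - 2 - η) := by
      rw [← Real.rpow_mul hl.le, ← Real.rpow_add hl]
      congr 1
      rw [h.a_eq]; ring
    have h5 : (n : ℝ) ^ (α - (1 + η)) = n * (n : ℝ) ^ (α - 2 - η) := by
      rw [← Real.rpow_one_add' hn0.le (by linarith [h.two_le])]
      congr 1; ring
    calc (n : ℝ) + l + 1 ≤ 3 * (n * l ^ η) := by nlinarith
      _ ≤ 3 * (n * (l ^ (-a) * (n : ℝ) ^ (α - 2 - η))) := by
          rw [h4]
          gcongr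
      _ = 3 * (l ^ (-a) * (n : ℝ) ^ (α - (1 + η))) := by rw [h5]; ring
      _ ≤ (3 + (l₀ + 2) * l₀ ^ a) * (l ^ (-a) * (n : ℝ) ^ (α - (1 + η))) := by
          gcongr
          linarith
      _ = _ := by ring

theorem one_le_rateConst (h : ScaleParams α η a m l₀) : 1 ≤ rateConst η a l₀ := by
  have hl₀ := h.one_le
  have h1 : 0 ≤ ∑' n : ℕ, 1 / (n : ℝ) ^ (1 + η) := tsum_nonneg fun _ => by positivity
  have h2 : 0 ≤ (l₀ + 2) * l₀ ^ a := by positivity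
  unfold rateConst
  nlinarith

/-- The front at scale `l` advances faster than the front at scale `l ^ (1 - η)`. -/
theorem advance (h : ScaleParams α η a m l₀) {l v : ℝ} (hl : l₀ ≤ l) (hv : 0 < v) {N : ℕ}
    (hN : (N : ℝ) < scaleTime η v l / scaleTime η v (l ^ (1 - η)) + 1) :
    ((N : ℝ) + 2 * m) * l ^ (1 - η) ≤ l - l ^ (1 - η) := by
  have hl1 : 1 ≤ l := h.one_le.trans hl
  have hl0 : 0 < l := by linarith
  have hη := h.pos
  have hη1 := h.lt_one
  set s := l ^ (1 - η) with hs
  have hs1 : 1 ≤ s := Real.one_le_rpow hl1 (by linarith)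
  have hs0 : 0 < s := by linarith
  set z := l ^ η with hz
  have hz0 : 0 < z := by positivity
  have hlz : l = z * s := by rw [hz, hs, ← Real.rpow_add hl0]; simp
  set w := s ^ (-η) with hw
  have hw0 : 0 < w := by positivity
  have hw1 : w ≤ 1 := Real.rpow_le_one_of_one_le_of_nonpos hs1 (by linarith)
  have hzw : 4 * (m : ℝ) + 5 ≤ z * w := by
    have : z * w = l ^ (η ^ 2) := by
      rw [hz, hw, hs, ← Real.rpow_mul hl0.le, ← Real.rpow_add hl0]
      congr 1; ring
    rw [this]
    exact h.le_rpow l hl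
  have hlη : l ^ (-η) = z⁻¹ := by rw [Real.rpow_neg hl0.le]
  have hratio : scaleTime η v l / scaleTime η v s = (z + 1) / (1 + w) := by
    unfold scaleTime
    rw [← hw, hlη, hlz]
    field_simp
  rw [hratio] at hN
  -- `z` windows of length `s` fit into `l`. As `w ≤ 1`, `(z - 2 - 2 m) (1 + w) ≥ z + z w - (4 m +
  -- 4)`, and `z w = l ^ (η ^ 2) ≥ 4 m + 5` makes this at least `z + 1`.
  have hkey : (z + 1) / (1 + w) + 1 + 2 * m + 1 ≤ z := by
    have : (z + 1) / (1 + w) ≤ z - 2 - 2 * m := by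
      rw [div_le_iff₀ (by linarith)]
      have hm0 : (0 : ℝ) ≤ m := by positivity
      nlinarith
    linarith
  have h1 : (N : ℝ) + 2 * m + 1 ≤ z := by linarith
  have h2 : ((N : ℝ) + 2 * m + 1) * s ≤ z * s := by gcongr
  rw [hlz]
  linarith

/-- The velocity is twice the rate constant, so that constant times `scaleTime` is at most `l`. The
base is then at most `l ^ (1 - a (1 - η))`, a negative power, and `m` was chosen for this. -/
theorem pow_le (h : ScaleParams α η a m l₀) {l : ℝ} (hl : l₀ ≤ l) :
    (rateConst η a l₀ * (l ^ (1 - η)) ^ (-a) *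
      scaleTime η (2 * rateConst η a l₀) l) ^ m ≤ l ^ (-a) := by
  have hl1 : 1 ≤ l := h.one_le.trans hl
  have hl0 : 0 < l := by linarith
  have hC := h.one_le_rateConst
  set C := rateConst η a l₀
  have h1 : l ^ (-η) ≤ 1 := Real.rpow_le_one_of_one_le_of_nonpos hl1 (by linarith [h.pos])
  have h2 : C * scaleTime η (2 * C) l ≤ l := by
    have : C * scaleTime η (2 * C) l = l * (1 + l ^ (-η)) / 2 := by
      unfold scaleTime; field_simp
    rw [this]
    nlinarith
  have h0 : 0 ≤ scaleTime η (2 * C) l := by unfold scaleTime; positivity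
  have h3 : C * (l ^ (1 - η)) ^ (-a) * scaleTime η (2 * C) l ≤ l ^ (1 - a * (1 - η)) := by
    calc _ = (l ^ (1 - η)) ^ (-a) * (C * scaleTime η (2 * C) l) := by ring
      _ ≤ (l ^ (1 - η)) ^ (-a) * l := by gcongr
      _ = l ^ (1 - a * (1 - η)) := by
          rw [← Real.rpow_mul hl0.le, ← Real.rpow_add_one hl0.ne']
          congr 1; ring
  calc _ ≤ (l ^ (1 - a * (1 - η))) ^ m := by gcongr
    _ = l ^ ((1 - a * (1 - η)) * m) := by rw [← Real.rpow_natCast, ← Real.rpow_mul hl0.le]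
    _ ≤ l ^ (-a) := Real.rpow_le_rpow_of_exponent_le hl1 (by linarith [h.le_m])

end ScaleParams

/-! ### Induction on scales -/

section Multiscale

variable {E ι : Type*} [NormedAddCommGroup E] [NormedSpace ℂ E]
  [Fintype ι] [DecidableEq ι] {φ : ι → ℝ} {W : Finset ι → Submodule ℂ E}
  {L : Finset ι → E →L[ℂ] E} {α η a l₀ lam J : ℝ} {m : ℕ}

theorem WindowBound.mono {l R τ p p' : ℝ} (h : WindowBound φ W L l R τ p) (hp : p ≤ p') :
    WindowBound φ W L l R τ p' := fun F D c x K t hD hF hx hK ht htτ =>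
  (h F D c x K t hD hF hx hK ht htτ).trans (by gcongr)

/-- The multiscale induction: at every scale the front moves with bounded velocity. -/
theorem LocalDynamics.windowBound [CompleteSpace E] (hL : LocalDynamics W L)
    (h : ScaleParams α η a m l₀)
    (hrate : ∀ l, 0 < l → RateBound φ L l (scaleRange η l₀ l) (lam * l ^ (-a)))
    (hJ : RateBound φ L 0 0 J) (hC : lam + J ≤ rateConst η a l₀) {l : ℝ} (hl : 0 < l) :
    WindowBound φ W L l (scaleRange η l₀ l) (scaleTime η (2 * rateConst η a l₀) l)
      (l ^ (-a)) := by
  -- For `l ≥ l₀` one has `l ^ η ≥ 2`, so passing to `l ^ (1 - η)` at least halves `l` and lowers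
  -- `n`.
  have main : ∀ (n : ℕ) (l : ℝ), 0 < l → l ≤ 2 ^ n →
      WindowBound φ W L l (scaleRange η l₀ l) (scaleTime η (2 * rateConst η a l₀) l)
        (l ^ (-a)) := by
    intro n
    induction n with
    | zero =>
      intro l hl hl1
      by_cases hll : l < l₀
      · rw [scaleRange, if_pos hll]
        exact WindowBound.of_range_zero hL hl.le (by positivity)
      · exfalso
        have hl' : l = 1 := le_antisymm (by simpa using hl1) (h.one_le.trans (not_lt.1 hll))
        have := h.le_rpow l (not_lt.1 hll)
        rw [hl', Real.one_rpow] at this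
        have : (0 : ℝ) ≤ m := by positivity
        linarith
    | succ n ih =>
      intro l hl hln
      by_cases hll : l < l₀
      · rw [scaleRange, if_pos hll]
        exact WindowBound.of_range_zero hL hl.le (by positivity)
      · have hl₀ : l₀ ≤ l := not_lt.1 hll
        have hl1 : 1 ≤ l := h.one_le.trans hl₀
        have hC1 := h.one_le_rateConst
        have hs0 : 0 < l ^ (1 - η) := by positivity
        have hs2 : l ^ (1 - η) ≤ 2 ^ n := by
          have h1 : l ^ (1 - η) * l ^ η = l := by
            rw [← Real.rpow_add hl]; simp
          have h2 : 2 ≤ l ^ η := by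
            have h3 := h.le_rpow l hl₀
            have h4 : l ^ (η ^ 2) ≤ l ^ η :=
              Real.rpow_le_rpow_of_exponent_le hl1 (by nlinarith [h.pos, h.lt_one])
            have : (0 : ℝ) ≤ m := by positivity
            linarith
          rw [pow_succ] at hln
          nlinarith
        have hτ : ∀ l : ℝ, 0 < l → 0 < scaleTime η (2 * rateConst η a l₀) l := fun l hl => by
          unfold scaleTime; positivity
        have hstep := (ih _ hs0 hs2).step hL (m := m) (l' := l)
          (T' := scaleTime η (2 * rateConst η a l₀) l)
          (μ := rateConst η a l₀ * (l ^ (1 - η)) ^ (-a))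
          (N := ⌈scaleTime η (2 * rateConst η a l₀) l /
            scaleTime η (2 * rateConst η a l₀) (l ^ (1 - η))⌉₊) hs0.le (hτ _ hs0) (by positivity)
          (hrate _ hs0) hJ ?_ ?_ ?_
        · rw [scaleRange, if_neg hll]
          exact hstep.mono (h.pow_le hl₀)
        · calc _ = (lam + J) * (l ^ (1 - η)) ^ (-a) := by ring
            _ ≤ _ := by gcongr
        · rw [← div_le_iff₀ (hτ _ hs0)]
          exact Nat.le_ceil _
        · refine h.advance hl₀ (v := 2 * rateConst η a l₀) (by positivity) (Nat.ceil_lt_add_one ?_)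
          exact div_nonneg (hτ _ hl).le (hτ _ hs0).le
  obtain ⟨n, hn⟩ := pow_unbounded_of_one_lt l (one_lt_two)
  exact main n l hl hn.le

end Multiscale

/-! ### Interfaces between `X` and `Y` -/

section Interfaces

variable {Λ : Finset ℤ}

/-- The position of a site on the line, read from left to right or from right to left. -/
def orient (b : Bool) (i : Λ) : ℤ := if b then i else -i

theorem orient_injective (b : Bool) : Function.Injective (orient b : Λ → ℤ) := by
  intro i j h
  refine Subtype.ext ?_
  cases b <;> simp only [orient, Bool.false_eq_true, if_false, if_true] at h <;> omega

theorem abs_orient_sub (b : Bool) (i j : Λ) :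
    |orient b i - orient b j| = |(i : ℤ) - (j : ℤ)| := by
  cases b
  · simp only [orient, Bool.false_eq_true, if_false]
    rw [neg_sub_neg, abs_sub_comm]
  · simp [orient]

/-- The position of a site, read in the direction from the first to the second site of `e`. -/
noncomputable def pairPos (e : Λ × Λ) (i : Λ) : ℝ := (orient (decide (e.1 < e.2)) i : ℤ)

theorem pairPos_of_lt {e : Λ × Λ} (h : e.1 < e.2) (i : Λ) : pairPos e i = ((i : ℤ) : ℝ) := by
  simp [pairPos, orient, h]

theorem pairPos_of_not_lt {e : Λ × Λ} (h : ¬ e.1 < e.2) (i : Λ) :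
    pairPos e i = -((i : ℤ) : ℝ) := by
  simp [pairPos, orient, h]

theorem coe_lt_coe_real {i j : Λ} : ((i : ℤ) : ℝ) < ((j : ℤ) : ℝ) ↔ i < j := by
  rw [Int.cast_lt, Subtype.coe_lt_coe]

/-- The pairs counted by `interfaceCount`. -/
noncomputable def interfaces (X Y : Finset Λ) : Finset (Λ × Λ) :=
  (X ×ˢ Y).filter fun p => ∀ z ∈ X ∪ Y, ¬ (min p.1 p.2 < z ∧ z < max p.1 p.2)

theorem siteDist_le {X Y : Finset Λ} {i j : Λ} (hi : i ∈ X) (hj : j ∈ Y) :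
    (siteDist X Y : ℝ) ≤ |((i : ℤ) : ℝ) - ((j : ℤ) : ℝ)| := by
  have h : siteDist X Y ≤ ((i : ℤ) - (j : ℤ)).natAbs := Nat.sInf_le ⟨i, hi, j, hj, rfl⟩
  have h1 : (siteDist X Y : ℝ) ≤ (((i : ℤ) - (j : ℤ)).natAbs : ℝ) := by exact_mod_cast h
  rw [Nat.cast_natAbs] at h1
  push_cast at h1
  exact h1

theorem siteDist_pos {X Y : Finset Λ} (hX : X.Nonempty) (hY : Y.Nonempty) (h : Disjoint X Y) :
    0 < siteDist X Y := by
  obtain ⟨i, hi⟩ := hX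
  obtain ⟨j, hj⟩ := hY
  obtain ⟨i, hi, j, hj, he⟩ := Nat.sInf_mem
    (s := {n : ℕ | ∃ i ∈ X, ∃ j ∈ Y, n = ((i : ℤ) - (j : ℤ)).natAbs}) ⟨_, i, hi, j, hj, rfl⟩
  rw [siteDist, he, Int.natAbs_pos, sub_ne_zero]
  intro h'
  have : i = j := Subtype.ext h'
  exact Finset.disjoint_left.1 h hi (this ▸ hj)

theorem pairPos_add_siteDist_le {X Y : Finset Λ} (hXY : Disjoint X Y) {e : Λ × Λ}
    (he : e ∈ interfaces X Y) : pairPos e e.1 + siteDist X Y ≤ pairPos e e.2 := by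
  obtain ⟨h1, h2⟩ := Finset.mem_product.1 (Finset.mem_filter.1 he).1
  have hd := siteDist_le h1 h2
  by_cases h : e.1 < e.2
  · rw [pairPos_of_lt h, pairPos_of_lt h]
    rw [abs_sub_comm, abs_of_pos (sub_pos.2 (coe_lt_coe_real.2 h))] at hd
    linarith
  · rw [pairPos_of_not_lt h, pairPos_of_not_lt h]
    have h' : e.2 < e.1 := lt_of_le_of_ne (not_lt.1 h) fun h' =>
      Finset.disjoint_left.1 hXY h1 (h' ▸ h2)
    rw [abs_of_pos (sub_pos.2 (coe_lt_coe_real.2 h'))] at hd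
    linarith

theorem pairPos_le_or_le {X Y : Finset Λ} {e : Λ × Λ} (he : e ∈ interfaces X Y) {z : Λ}
    (hz : z ∈ X ∪ Y) : pairPos e z ≤ pairPos e e.1 ∨ pairPos e e.2 ≤ pairPos e z := by
  have h := (Finset.mem_filter.1 he).2 z hz
  by_contra hc
  push Not at hc
  apply h
  by_cases hlt : e.1 < e.2
  · simp only [pairPos_of_lt hlt, coe_lt_coe_real] at hc
    rwa [min_eq_left hlt.le, max_eq_right hlt.le]
  · simp only [pairPos_of_not_lt hlt, neg_lt_neg_iff, coe_lt_coe_real] at hc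
    rw [min_eq_right (not_lt.1 hlt), max_eq_left (not_lt.1 hlt)]
    exact ⟨hc.2, hc.1⟩

/-- Between a site of `X` and a site of `Y` there is an interface with the same orientation. -/
theorem exists_interface {X Y : Finset Λ} (hXY : Disjoint X Y) {x y : Λ} (hx : x ∈ X)
    (hy : y ∈ Y) : ∃ e ∈ interfaces X Y, pairPos e = pairPos (x, y) ∧
      pairPos e x ≤ pairPos e e.1 ∧ pairPos e e.2 ≤ pairPos e y := by
  have hne : ∀ {i j : Λ}, i ∈ X → j ∈ Y → i ≠ j := fun hi hj h =>
    Finset.disjoint_left.1 hXY hi (h ▸ hj)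
  by_cases hlt : x < y
  · obtain ⟨e, he, hmin⟩ := Finset.exists_min_image
      ((X ×ˢ Y).filter fun e => x ≤ e.1 ∧ e.1 < e.2 ∧ e.2 ≤ y)
      (fun e => ((e.2 : Λ) : ℤ) - ((e.1 : Λ) : ℤ))
      ⟨(x, y), Finset.mem_filter.2 ⟨Finset.mk_mem_product hx hy, le_rfl, hlt, le_rfl⟩⟩
    obtain ⟨hp, h1, h2, h3⟩ := Finset.mem_filter.1 he
    obtain ⟨he1, he2⟩ := Finset.mem_product.1 hp
    have hpos : pairPos e = pairPos (x, y) := by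
      funext i
      rw [pairPos_of_lt h2, pairPos_of_lt (e := (x, y)) hlt]
    refine ⟨e, Finset.mem_filter.2 ⟨hp, fun z hz hzb => ?_⟩, hpos, ?_, ?_⟩
    · rw [min_eq_left h2.le, max_eq_right h2.le] at hzb
      have hz1 : ((e.1 : Λ) : ℤ) < z := hzb.1
      have hz2 : (z : ℤ) < ((e.2 : Λ) : ℤ) := hzb.2
      rcases Finset.mem_union.1 hz with hz | hz
      · have := hmin (z, e.2) (Finset.mem_filter.2
          ⟨Finset.mk_mem_product hz he2, h1.trans hzb.1.le, hzb.2, h3⟩)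
        simp only at this
        omega
      · have := hmin (e.1, z) (Finset.mem_filter.2
          ⟨Finset.mk_mem_product he1 hz, h1, hzb.1, hzb.2.le.trans h3⟩)
        simp only at this
        omega
    · simp only [pairPos_of_lt h2]
      exact_mod_cast h1
    · simp only [pairPos_of_lt h2]
      exact_mod_cast h3
  · have hgt : y < x := lt_of_le_of_ne (not_lt.1 hlt) (hne hx hy).symm
    obtain ⟨e, he, hmin⟩ := Finset.exists_min_image
      ((X ×ˢ Y).filter fun e => e.1 ≤ x ∧ e.2 < e.1 ∧ y ≤ e.2)
      (fun e => ((e.1 : Λ) : ℤ) - ((e.2 : Λ) : ℤ))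
      ⟨(x, y), Finset.mem_filter.2 ⟨Finset.mk_mem_product hx hy, le_rfl, hgt, le_rfl⟩⟩
    obtain ⟨hp, h1, h2, h3⟩ := Finset.mem_filter.1 he
    obtain ⟨he1, he2⟩ := Finset.mem_product.1 hp
    have h2' : ¬ e.1 < e.2 := not_lt.2 h2.le
    have hpos : pairPos e = pairPos (x, y) := by
      funext i
      rw [pairPos_of_not_lt h2', pairPos_of_not_lt (e := (x, y)) hlt]
    refine ⟨e, Finset.mem_filter.2 ⟨hp, fun z hz hzb => ?_⟩, hpos, ?_, ?_⟩
    · rw [min_eq_right h2.le, max_eq_left h2.le] at hzb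
      have hz1 : ((e.2 : Λ) : ℤ) < z := hzb.1
      have hz2 : (z : ℤ) < ((e.1 : Λ) : ℤ) := hzb.2
      rcases Finset.mem_union.1 hz with hz | hz
      · have := hmin (z, e.2) (Finset.mem_filter.2
          ⟨Finset.mk_mem_product hz he2, hzb.2.le.trans h1, hzb.1, h3⟩)
        simp only at this
        omega
      · have := hmin (e.1, z) (Finset.mem_filter.2
          ⟨Finset.mk_mem_product he1 hz, h1, hzb.2, h3.trans hzb.1.le⟩)
        simp only at this
        omega
    · simp only [pairPos_of_not_lt h2', neg_le_neg_iff]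
      exact_mod_cast h1
    · simp only [pairPos_of_not_lt h2', neg_le_neg_iff]
      exact_mod_cast h3

end Interfaces

/-- Bound on the weight that passes from `X` to `Y`, in terms of the weights that cross the windows
next to the interfaces. -/
theorem LocalDynamics.norm_apply_exp_le_interfaces {E : Type*} [NormedAddCommGroup E]
    [NormedSpace ℂ E] [CompleteSpace E] {Λ : Finset ℤ} {W : Finset Λ → Submodule ℂ E}
    {L : Finset Λ → E →L[ℂ] E} (hL : LocalDynamics W L) {l R τ p lam J : ℝ} (hp : 0 ≤ p)
    (hW : ∀ e : Λ × Λ, WindowBound (pairPos e) W L l R τ p)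
    (hlam : ∀ e : Λ × Λ, RateBound (pairPos e) L l R lam)
    (hJ : ∀ e : Λ × Λ, RateBound (pairPos e) L 0 0 J) {X Y : Finset Λ} (hXY : Disjoint X Y)
    (hl : 0 ≤ l) (hlr : l < siteDist X Y) (hlR : l + R ≤ siteDist X Y) {x : E}
    (hx : x ∈ W X) {K : E →L[ℂ] E} (hK : ∀ y ∈ W Yᶜ, K y = 0) {t : ℝ} (ht : 0 ≤ t)
    (htτ : t ≤ τ) :
    ‖K (NormedSpace.exp ((t : ℂ) • ∑ Z, L Z) x)‖ ≤
      ‖K‖ * ((interfaces X Y).card * ((lam + p * J) * ‖x‖)) * t := by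
  classical
  set I := interfaces X Y with hI
  let side : Λ × Λ → Λ → Prop := fun e i => pairPos e i ≤ pairPos e e.1 + l
  -- The window ends cut the line into cells, and `U` consists of the cells that meet `X`. Retained
  -- terms never leave a cell, so `U` stays decoupled from the rest.
  let U : Finset Λ := Finset.univ.filter fun i => ∃ x ∈ X, ∀ e ∈ I, (side e i ↔ side e x)
  let del : Λ × Λ → Finset Λ → Prop := fun e Z => ∃ i ∈ Z, ∃ j ∈ Z, side e i ∧
    pairPos e e.1 < pairPos e j ∧ (R < pairPos e j - pairPos e i ∨ ¬ side e j)
  let F : Finset (Finset Λ) := Finset.univ.filter fun Z => ∀ e ∈ I, ¬ del e Z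
  have hgap : ∀ e ∈ I, pairPos e e.1 + siteDist X Y ≤ pairPos e e.2 := fun e he =>
    pairPos_add_siteDist_le hXY he
  have hXU : X ⊆ U := fun i hi => Finset.mem_filter.2 ⟨Finset.mem_univ _, i, hi, fun _ _ => Iff.rfl⟩
  have hsame : ∀ Z ∈ F, ∀ e ∈ I, ∀ i ∈ Z, ∀ j ∈ Z, side e i → side e j := by
    intro Z hZ e he i hi j hj hsi
    by_contra hsj
    have h1 : pairPos e e.1 + l < pairPos e j := not_le.1 hsj
    exact (Finset.mem_filter.1 hZ).2 e he ⟨i, hi, j, hj, hsi, by linarith, Or.inr hsj⟩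
  have hFU : ∀ Z ∈ F, Z ⊆ U ∨ Disjoint Z U := by
    intro Z hZ
    by_cases h : ∃ i ∈ Z, i ∈ U
    · obtain ⟨i, hi, hiU⟩ := h
      obtain ⟨x, hx, hix⟩ := (Finset.mem_filter.1 hiU).2
      refine Or.inl fun j hj => Finset.mem_filter.2 ⟨Finset.mem_univ _, x, hx, fun e he => ?_⟩
      rw [← hix e he]
      exact ⟨hsame Z hZ e he j hj i hi, hsame Z hZ e he i hi j hj⟩
    · push Not at h
      exact Or.inr (Finset.disjoint_left.2 h)
  -- A site of `X` behind `e.1` is separated from `j` by the window of `e`; one beyond `e.2` is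
  -- separated by the window of an interface between it and `e.2`.
  have hbeyond : ∀ e ∈ I, ∀ j, ¬ side e j → pairPos e j ≤ pairPos e e.2 → j ∉ U := by
    intro e he j hj hje hjU
    obtain ⟨x, hx, hjx⟩ := (Finset.mem_filter.1 hjU).2
    obtain ⟨he1, he2⟩ := Finset.mem_product.1 (Finset.mem_filter.1 he).1
    rcases pairPos_le_or_le he (Finset.mem_union_left Y hx) with h | h
    · have : side e x := le_trans h (by linarith)
      exact hj ((hjx e he).2 this)
    · obtain ⟨e', he', hpos, h1, h2⟩ := exists_interface hXY hx he2
      have hsx : side e' x := le_trans h1 (by linarith)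
      have hsj : side e' j := (hjx e' he').2 hsx
      have hg := hgap e' he'
      have hje' : pairPos e' e.2 ≤ pairPos e' j := by
        have hne : x ≠ e.2 := fun h' => Finset.disjoint_left.1 hXY hx (h' ▸ he2)
        by_cases hlt : e.1 < e.2
        · simp only [pairPos_of_lt hlt] at h hje
          have hx2 : ¬ x < e.2 := fun h' => absurd (coe_lt_coe_real.2 h') (not_lt.2 h)
          rw [hpos, pairPos_of_not_lt (e := (x, e.2)) hx2, pairPos_of_not_lt (e := (x, e.2)) hx2]
          linarith
        · simp only [pairPos_of_not_lt hlt] at h hje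
          have hx2 : x < e.2 := lt_of_le_of_ne (by
            rw [← not_lt, ← coe_lt_coe_real]
            linarith) hne
          rw [hpos, pairPos_of_lt (e := (x, e.2)) hx2, pairPos_of_lt (e := (x, e.2)) hx2]
          linarith
      have : pairPos e' j ≤ pairPos e' e'.1 + l := hsj
      linarith
  have hUY : U ⊆ Yᶜ := by
    intro y hyU
    rw [Finset.mem_compl]
    intro hy
    obtain ⟨x, hx, hyx⟩ := (Finset.mem_filter.1 hyU).2
    obtain ⟨e, he, -, h1, h2⟩ := exists_interface hXY hx hy
    have hsx : side e x := le_trans h1 (by linarith)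
    have hsy : pairPos e y ≤ pairPos e e.1 + l := (hyx e he).2 hsx
    have := hgap e he
    linarith
  have hend : K (NormedSpace.exp ((t : ℂ) • ∑ Z ∈ F, L Z) x) = 0 :=
    hK _ (hL.mono _ _ hUY (hL.exp_mem hFU _ (hL.mono _ _ hXU hx)))
  have hcover : Finset.univ \ F ⊆ I.biUnion fun e => Finset.univ.filter fun Z => del e Z := by
    intro Z hZ
    have h : Z ∉ F := (Finset.mem_sdiff.1 hZ).2
    have h' : ¬ ∀ e ∈ I, ¬ del e Z := fun h' => h (Finset.mem_filter.2 ⟨Finset.mem_univ _, h'⟩)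
    push Not at h'
    obtain ⟨e, he, hd⟩ := h'
    exact Finset.mem_biUnion.2 ⟨e, he, Finset.mem_filter.2 ⟨Finset.mem_univ _, hd⟩⟩
  have h := LocalDynamics.norm_apply_exp_le (L := L) K (Finset.subset_univ F) x (T := t) (τ := t)
    (B := ‖K‖) (C := I.card * ((lam + p * J) * ‖x‖)) ht (norm_nonneg _) ?_ ?_
  · refine h.trans (le_of_eq ?_)
    rw [sub_self, Complex.ofReal_zero, zero_smul, NormedSpace.exp_zero]
    change ‖K (NormedSpace.exp ((t : ℂ) • ∑ Z ∈ F, L Z) x)‖ + _ = _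
    rw [hend, norm_zero, zero_add]
  · intro s _ hst Z _
    exact (K.le_opNorm _).trans
      (mul_le_mul_of_nonneg_left (hL.norm_exp_le _ _ (by linarith) _) (norm_nonneg _))
  · intro s hs hst
    refine (Finset.sum_le_sum_of_subset_of_nonneg hcover fun _ _ _ => norm_nonneg _).trans ?_
    refine (Finset.sum_biUnion_le_sum_sum _ _ fun _ => norm_nonneg _).trans ?_
    rw [← nsmul_eq_mul]
    refine Finset.sum_le_card_nsmul _ _ _ fun e he => ?_
    -- When `X` surrounds parts of `Y`, it also has sites beyond `e.2`. These lie in `U` beyond the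
    -- window, and leaving them out of `D` makes them spectators.
    refine hL.sum_norm_apply_le (D := Finset.univ.filter fun i => side e i ∨ i ∉ U)
      (c := pairPos e e.1) hp (hW e) (hlam e) (hJ e) ?_ ?_ ?_ hs (hst.trans htτ) ?_
    · intro Z hZ
      by_cases hs : ∃ i ∈ Z, side e i
      · obtain ⟨i, hi, hsi⟩ := hs
        exact Or.inl fun j hj => Finset.mem_filter.2
          ⟨Finset.mem_univ _, Or.inl (hsame Z hZ e he i hi j hj hsi)⟩
      · push Not at hs
        rcases hFU Z hZ with h | h
        · refine Or.inr (Finset.disjoint_left.2 fun i hi hi' => ?_)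
          exact (Finset.mem_filter.1 hi').2.elim (hs i hi) fun h' => h' (h hi)
        · exact Or.inl fun i hi => Finset.mem_filter.2
            ⟨Finset.mem_univ _, Or.inr (Finset.disjoint_left.1 h hi)⟩
    · intro Z hZ i hi j hj _ _ hil hjc
      by_contra hc
      exact (Finset.mem_filter.1 hZ).2 e he ⟨i, hi, j, hj, hil, hjc, Or.inl (not_le.1 hc)⟩
    · refine hL.mono X _ (fun z hz => ?_) hx
      rw [Finset.mem_compl]
      intro hz'
      obtain ⟨hzD, hzc⟩ := Finset.mem_filter.1 hz'
      have hzs : pairPos e z ≤ pairPos e e.1 + l :=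
        (Finset.mem_filter.1 hzD).2.resolve_right fun h => h (hXU hz)
      have := hgap e he
      rcases pairPos_le_or_le he (Finset.mem_union_left Y hz) with h | h <;> linarith
    · intro Z hZ
      obtain ⟨i, hi, j, hj, hsi, hjc, h⟩ := (Finset.mem_filter.1 hZ).2
      by_cases hRl : R < pairPos e j - pairPos e i
      · exact Or.inl ⟨i, hi, j, hj, hsi, hjc, hRl⟩
      · have hsj := h.resolve_left hRl
        have hsi' : pairPos e i ≤ pairPos e e.1 + l := hsi
        have := hgap e he
        refine Or.inr ⟨i, hi, j, hj, Finset.mem_filter.2 ⟨Finset.mem_univ _, Or.inl hsi⟩,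
          Finset.mem_filter.2 ⟨Finset.mem_univ _, Or.inr (hbeyond e he j hsj (by linarith))⟩,
          hsi, not_le.1 hsj, not_lt.1 hRl⟩

/-! ### Application to long-range Liouvillians -/

section LongRange

variable {d : ℤ → ℕ} {Λ : Finset ℤ}

theorem IsTwoBodyLongRange.localDynamics {α : ℝ} {L : Finset Λ → SuperOp d Λ}
    (hL : IsTwoBodyLongRange α L) : LocalDynamics (supportSubmodule d) L where
  isClosed := isClosed_supportSubmodule
  mono _ _ hST _ hO := SupportedOn.mono hST hO
  apply_mem Z _ hZS _ hO := (hL.liouvillian Z).supportedOn_apply hZS hO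
  apply_eq_zero Z _ hZS _ hO := (hL.liouvillian Z).killsOff _
    (SupportedOn.mono (Finset.subset_compl_iff_disjoint_left.2 hZS) hO)
  norm_exp_le F _ ht O :=
    (IsDissipative.sum F fun Z _ => (hL.liouvillian Z).isDissipative).norm_exp_apply_le ht O
  twoBody := hL.twoBody

theorem IsTwoBodyLongRange.rateBound {α : ℝ} {L : Finset Λ → SuperOp d Λ}
    (hL : IsTwoBodyLongRange α L) (e : Λ × Λ) {l R A β : ℝ} (hR : 0 ≤ R) (hβ : 1 < β)
    (hA0 : 0 ≤ A)
    (hA : ∀ n : ℕ, 1 ≤ n → R < n → (n : ℝ) + l + 1 ≤ A * (n : ℝ) ^ (α - β)) :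
    RateBound (pairPos e) L l R (A * ∑' n : ℕ, 1 / (n : ℝ) ^ β) := by
  refine rateBound_of_decay (orient_injective (decide (e.1 < e.2))) (fun i j hij => ?_)
    hR hβ hA0 hA
  refine (hL.decay i j hij).trans (le_of_eq ?_)
  have h := congrArg (Int.cast : ℤ → ℝ) (abs_orient_sub (decide (e.1 < e.2)) i j)
  push_cast at h
  rw [h]

end LongRange

theorem ScaleParams.scaleRange_le {α η a l₀ : ℝ} {m : ℕ} (h : ScaleParams α η a m l₀) {l : ℝ}
    (hl : 0 ≤ l) : scaleRange η l₀ l ≤ l := by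
  unfold scaleRange
  split_ifs with hll
  · exact hl
  · calc l ^ (1 - η) ≤ l ^ (1 : ℝ) :=
        Real.rpow_le_rpow_of_exponent_le (h.one_le.trans (not_lt.1 hll)) (by linarith [h.pos])
      _ = l := Real.rpow_one l

theorem mainTheorem4 (α : ℝ) (hα : 3 < α) (ε : ℝ) (hε : 0 < ε) :
    ∃ C v : ℝ, 0 < C ∧ 0 < v ∧
      ∀ (Λ : Finset ℤ) (d : ℤ → ℕ), (∀ i, 0 < d i) →
      ∀ L : Finset Λ → SuperOp d Λ, IsTwoBodyLongRange α L →
      ∀ X Y : Finset Λ, X.Nonempty → Y.Nonempty → Disjoint X Y →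
      ∀ A : Op d Λ, SupportedOn X A →
      ∀ K : SuperOp d Λ, SuperSupportedOn Y K → K 1 = 0 →
      ∀ t : ℝ, 0 ≤ t → t ≤ (siteDist X Y : ℝ) / v →
        ‖K (NormedSpace.exp ((t : ℂ) • ∑ Z, L Z) A)‖ ≤
          C * (interfaceCount X Y : ℝ) * ‖K‖ * ‖A‖ *
            (t / (siteDist X Y : ℝ) ^ (α - 2 - ε)) := by
  obtain ⟨η, a, m, l₀, h, ha⟩ := exists_scaleParams hα hε
  have hl₀ := h.one_le
  have hη := h.pos
  have hC1 := h.one_le_rateConst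
  set C₁ := rateConst η a l₀ with hC₁
  -- Windows of length `r / 2` leave room for a last hop of range at most `r / 2`. They give `(r /
  -- 2) ^ (-a) = 2 ^ a * r ^ (-a)`, and at velocity parameter `2 * C₁` the scale time is at least `r
  -- / (4 * C₁)`.
  refine ⟨C₁ * 2 ^ a, 4 * C₁, by positivity, by positivity, ?_⟩
  intro Λ d _ L hL X Y hX hY hXY A hA K hK hK1 t ht htr
  set r : ℝ := (siteDist X Y : ℝ) with hr
  have hr1 : 1 ≤ r := Nat.one_le_cast.2 (siteDist_pos hX hY hXY)
  set ζ : ℝ := ∑' n : ℕ, 1 / (n : ℝ) ^ (1 + η) with hζ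
  have hζ0 : 0 ≤ ζ := tsum_nonneg fun _ => by positivity
  set A₀ : ℝ := 3 + (l₀ + 2) * l₀ ^ a with hA₀
  have hA₀0 : 0 ≤ A₀ := by positivity
  have hrate : ∀ (e : Λ × Λ) (l : ℝ), 0 < l →
      RateBound (pairPos e) L l (scaleRange η l₀ l) (A₀ * ζ * l ^ (-a)) := by
    intro e l hl
    have := hL.rateBound e (l := l) (A := A₀ * l ^ (-a)) (ScaleParams.scaleRange_nonneg hl.le)
      (by linarith : 1 < 1 + η) (by positivity) fun n hn hln => h.add_one_le hl hn hln
    rwa [mul_right_comm] at this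
  have hJ : ∀ e : Λ × Λ, RateBound (pairPos e) L 0 0 (2 * ζ) := by
    intro e
    refine hL.rateBound e le_rfl (by linarith) (by norm_num) fun n hn _ => ?_
    have hn1 : (1 : ℝ) ≤ n := by exact_mod_cast hn
    have : (n : ℝ) ^ (1 : ℝ) ≤ (n : ℝ) ^ (α - (1 + η)) :=
      Real.rpow_le_rpow_of_exponent_le hn1 (by linarith [h.two_le])
    rw [Real.rpow_one] at this
    linarith
  have hCle : A₀ * ζ + 2 * ζ ≤ C₁ := by
    have : C₁ = (A₀ + 2) * (1 + ζ) := by rw [hC₁, rateConst, hA₀, hζ]; ring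
    rw [this]
    linarith
  have hl : 0 < r / 2 := by linarith
  have hW := fun e => hL.localDynamics.windowBound h (hrate e) (hJ e) hCle hl
  have hbound := hL.localDynamics.norm_apply_exp_le_interfaces (by positivity) hW
    (fun e => hrate e _ hl) hJ hXY hl.le (by linarith)
    (by linarith [h.scaleRange_le hl.le]) hA (K := K) (hK.killsOff hK1) ht ?_
  · refine hbound.trans ?_
    have hcard : ((interfaces X Y).card : ℝ) = interfaceCount X Y := rfl
    have hpow : (r / 2) ^ (-a) ≤ 2 ^ a * (1 / r ^ (α - 2 - ε)) := by
      rw [Real.rpow_neg hl.le, Real.div_rpow (by linarith) (by norm_num), inv_div, div_eq_mul_one_div]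
      gcongr
    rw [hcard]
    calc _ = (A₀ * ζ + 2 * ζ) * (r / 2) ^ (-a) * interfaceCount X Y * ‖K‖ * ‖A‖ * t := by ring
      _ ≤ C₁ * (2 ^ a * (1 / r ^ (α - 2 - ε))) * interfaceCount X Y * ‖K‖ * ‖A‖ * t := by
          gcongr
      _ = _ := by ring
  · refine htr.trans ?_
    have : 0 ≤ (r / 2) ^ (-η) := by positivity
    rw [scaleTime, div_le_div_iff₀ (by positivity) (by positivity)]
    have : r / 2 * 1 ≤ r / 2 * (1 + (r / 2) ^ (-η)) := by gcongr; linarith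
    nlinarith
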